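/- Let $n,p\in\mathbb N$, $a\in\mathbb C$, $a\neq 0$, $c\in\mathbb R$, and let $A$ be an $n\times n$ complex matrix with $\det\big((A-cI_n)^2-|a|^2I_n\big)\neq 0$. Let $Q$ be any $n\times n$ matrix with $AQ=QA$ and $Q^2=(A-cI_n)^2-|a|^2I_n$. For $f_1,f_2\in\mathbb C^{n\times p}$ put $f_3=\overline a^{\,-1}(Q+A-cI_n)f_1$, $f_4=-\overline a^{\,-1}(Q-A+cI_n)f_2$ and $$\Lambda_1(x)=e^{-icx}\big(e^{ixQ}f_1+e^{-ixQ}f_2\big),\qquad \Lambda_2(x)=e^{icx}\big(e^{ixQ}f_3+e^{-ixQ}f_4\big),\qquad \Pi(x)=\begin{bmatrix}\Lambda_1(x)&\Lambda_2(x)\end{bmatrix}.$$ Let $j=\mathrm{diag}(I_p,-I_p)$, let $S(0)>0$ be a positive definite $n\times n$ matrix with $AS(0)-S(0)A^*=i\,\Pi(0)j\Pi(0)^*$, and set, for $x\ge 0$, $$S(x)=S(0)+\int_0^x\Pi(r)\Pi(r)^*\,dr,\qquad \widetilde v(x)=a e^{2icx}I_p-2i\,\Lambda_1(x)^*S(x)^{-1}\Lambda_2(x),\qquad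 \widetilde V(x)=\begin{bmatrix}0&\widetilde v(x)\\ \widetilde v(x)^*&0\end{bmatrix}.$$ Let $W(x,z)$ be the fundamental solution, normalised by $W(0,z)=I_{2p}$, of the self-adjoint Dirac system $y'(x,z)=i\big(zj+j\widetilde V(x)\big)y(x,z)$ on $[0,\infty)$. A $p\times p$ matrix function $\varphi$ on $\mathbb C_+=\{z:\Im z>0\}$ is called a Weyl function of this system if, for all $z\in\mathbb C_+$, $$\int_0^\infty \begin{bmatrix}I_p& i\varphi(z)^*\end{bmatrix}\Theta W(x,z)^*W(x,z)\Theta^*\begin{bmatrix}I_p\\-i\varphi(z)\end{bmatrix}dx<\infty,\qquad \Theta=\frac1{\sqrt2}\begin{bmatrix}I_p&-I_p\\ I_p&I_p\end{bmatrix}.$$ For $z\in\mathbb C_+$ let $\zeta(z)$ be the square root of $(z-c)^2-|a|^2$ that lies in $\mathbb C_+$, let $h(z)=\zeta(z)-z+c$, and put $$\mathcal D=\frac{a+h(z)}{\sqrt2}I_p,\quad \mathcal C_1=i\big(a-h(z)\big)^{-1}\big(\Lambda_1(0)^*+\Lambda_2(0)^*\big)S(0)^{-1},\quad \mathcal C_2=\frac{i}{\sqrt2}\big(\Lambda_1(0)^*-\Lambda_2(0)^*\big)S(0)^{-1},$$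 $$\mathcal B=a\Lambda_1(0)+h(z)\Lambda_2(0),\qquad \mathcal A^\times=A-\mathcal B\,\mathcal C_1 .$$ Then $S(x)$ is invertible for every $x\ge 0$, $a-h(z)\ne0$ and $\mathcal A^\times-zI_n$ is invertible for every $z\in\mathbb C_+$, and the system has exactly one Weyl function on $\mathbb C_+$, namely $$\varphi(z)=i\sqrt2\,\big(a-h(z)\big)^{-1}\Big(\mathcal D+(\mathcal D\,\mathcal C_1-\mathcal C_2)(\mathcal A^\times-zI_n)^{-1}\mathcal B\Big),\qquad z\in\mathbb C_+ .$$ -/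

import Mathlib

open Complex Matrix MeasureTheory Set
open scoped ComplexOrder

noncomputable section

namespace DiracWeyl

/-! Self-adjoint Dirac systems `y' = i (z j + j V) y` on `[0, ∞)` and their Weyl functions. -/

/-- The signature matrix `j = diag(I_p, -I_p)`. -/
def jMat (p : ℕ) : Matrix (Fin p ⊕ Fin p) (Fin p ⊕ Fin p) ℂ :=
  fromBlocks 1 0 0 (-1)

/-- The matrix `V = [[0, v], [v^*, 0]]` built from a `p × p` block `v`. -/
def potMat {p : ℕ} (v : Matrix (Fin p) (Fin p) ℂ) :
    Matrix (Fin p ⊕ Fin p) (Fin p ⊕ Fin p) ℂ :=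
  fromBlocks 0 v vᴴ 0

/-- `W` is the fundamental solution on `[0, ∞)`, normalised by `W(0) = I_{2p}`, of the self-adjoint
Dirac system `y' = i (z j + j V(x)) y` with potential `v`. The derivative is taken
entrywise, and one-sided at `x = 0`. -/
def IsNormalisedFundamentalSolution {p : ℕ} (v : ℝ → Matrix (Fin p) (Fin p) ℂ) (z : ℂ)
    (W : ℝ → Matrix (Fin p ⊕ Fin p) (Fin p ⊕ Fin p) ℂ) : Prop :=
  W 0 = 1 ∧ ∀ x : ℝ, 0 ≤ x → ∀ k l : Fin p ⊕ Fin p,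
    HasDerivWithinAt (fun t : ℝ => W t k l)
      ((I • ((z • jMat p + jMat p * potMat (v x)) * W x)) k l) (Ici 0) x

/-- The unitary matrix `Θ = 2^{-1/2} [[I, -I], [I, I]]`. -/
def Theta (p : ℕ) : Matrix (Fin p ⊕ Fin p) (Fin p ⊕ Fin p) ℂ :=
  ((Real.sqrt 2 : ℝ) : ℂ)⁻¹ • fromBlocks 1 (-1) 1 1

/-- The integrand `[I, i φ^*] Θ W^* W Θ^* [I; -i φ]`. -/
def weylIntegrand {p : ℕ} (φ : Matrix (Fin p) (Fin p) ℂ)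
    (W : Matrix (Fin p ⊕ Fin p) (Fin p ⊕ Fin p) ℂ) : Matrix (Fin p) (Fin p) ℂ :=
  fromCols (1 : Matrix (Fin p) (Fin p) ℂ) (I • φᴴ) * Theta p * Wᴴ * W * (Theta p)ᴴ *
    fromRows (1 : Matrix (Fin p) (Fin p) ℂ) (-(I • φ))

/-- `φ` is a Weyl function on `[0, ∞)` of the Dirac system with potential `v`: for every `z` in the
open upper half-plane the integral over `(0, ∞)` of the (positive semidefinite) matrix function
`weylIntegrand (φ z) (W x)` is finite, `W` being the normalised fundamental solution. -/
def IsWeylFunction {p : ℕ} (v : ℝ → Matrix (Fin p) (Fin p) ℂ)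
    (φ : ℂ → Matrix (Fin p) (Fin p) ℂ) : Prop :=
  ∀ z : ℂ, 0 < z.im → ∃ W : ℝ → Matrix (Fin p ⊕ Fin p) (Fin p ⊕ Fin p) ℂ,
    IsNormalisedFundamentalSolution v z W ∧
      ∀ k l : Fin p, IntegrableOn (fun x : ℝ => weylIntegrand (φ z) (W x) k l) (Ioi 0)

/-! The transformed system: initial potential `a e^{2icx} I_p`, parameters `A`, `Q`, `f₁`, `f₂`,
`S(0)`. -/

/-- The initial potential `v(x) = a e^{2icx} I_p`. -/
def initialPot (p : ℕ) (a : ℂ) (c : ℝ) (x : ℝ) : Matrix (Fin p) (Fin p) ℂ :=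
  (a * cexp (2 * I * c * x)) • 1

/-- `f₃ = (1/ā) (Q + A - c I) f₁`. -/
def f3 {n p : ℕ} (a : ℂ) (c : ℝ) (A Q : Matrix (Fin n) (Fin n) ℂ)
    (f1 : Matrix (Fin n) (Fin p) ℂ) : Matrix (Fin n) (Fin p) ℂ :=
  (1 / (starRingEnd ℂ a)) • ((Q + A - (c : ℂ) • 1) * f1)

/-- `f₄ = -(1/ā) (Q - A + c I) f₂`. -/
def f4 {n p : ℕ} (a : ℂ) (c : ℝ) (A Q : Matrix (Fin n) (Fin n) ℂ)
    (f2 : Matrix (Fin n) (Fin p) ℂ) : Matrix (Fin n) (Fin p) ℂ :=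
  -((1 / (starRingEnd ℂ a)) • ((Q - A + (c : ℂ) • 1) * f2))

/-- `Λ₁(x) = e^{-icx} (e^{ixQ} f₁ + e^{-ixQ} f₂)`. -/
def Lam1 {n p : ℕ} (c : ℝ) (Q : Matrix (Fin n) (Fin n) ℂ)
    (f1 f2 : Matrix (Fin n) (Fin p) ℂ) (x : ℝ) : Matrix (Fin n) (Fin p) ℂ :=
  cexp (-(I * c * x)) •
    (NormedSpace.exp ((I * x) • Q) * f1 + NormedSpace.exp (-((I * x) • Q)) * f2)

/-- `Λ₂(x) = e^{icx} (e^{ixQ} f₃ + e^{-ixQ} f₄)`. -/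
def Lam2 {n p : ℕ} (a : ℂ) (c : ℝ) (A Q : Matrix (Fin n) (Fin n) ℂ)
    (f1 f2 : Matrix (Fin n) (Fin p) ℂ) (x : ℝ) : Matrix (Fin n) (Fin p) ℂ :=
  cexp (I * c * x) •
    (NormedSpace.exp ((I * x) • Q) * f3 a c A Q f1 +
      NormedSpace.exp (-((I * x) • Q)) * f4 a c A Q f2)

/-- `Π(x) = [Λ₁(x)  Λ₂(x)]`. -/
def PiMat {n p : ℕ} (a : ℂ) (c : ℝ) (A Q : Matrix (Fin n) (Fin n) ℂ)
    (f1 f2 : Matrix (Fin n) (Fin p) ℂ) (x : ℝ) : Matrix (Fin n) (Fin p ⊕ Fin p) ℂ :=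
  fromCols (Lam1 c Q f1 f2 x) (Lam2 a c A Q f1 f2 x)

/-- `S(x) = S(0) + ∫₀ˣ Π(r) Π(r)^* dr` (entrywise integral). -/
def SMat {n p : ℕ} (a : ℂ) (c : ℝ) (A Q : Matrix (Fin n) (Fin n) ℂ)
    (f1 f2 : Matrix (Fin n) (Fin p) ℂ) (S0 : Matrix (Fin n) (Fin n) ℂ) (x : ℝ) :
    Matrix (Fin n) (Fin n) ℂ :=
  S0 + Matrix.of fun k l =>
    ∫ r in (0 : ℝ)..x, (PiMat a c A Q f1 f2 r * (PiMat a c A Q f1 f2 r)ᴴ) k l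

/-- The transformed potential `ṽ(x) = v(x) - 2 i Λ₁(x)^* S(x)⁻¹ Λ₂(x)`. -/
def transformedPot {n p : ℕ} (a : ℂ) (c : ℝ) (A Q : Matrix (Fin n) (Fin n) ℂ)
    (f1 f2 : Matrix (Fin n) (Fin p) ℂ) (S0 : Matrix (Fin n) (Fin n) ℂ) (x : ℝ) :
    Matrix (Fin p) (Fin p) ℂ :=
  initialPot p a c x - (2 * I) •
    ((Lam1 c Q f1 f2 x)ᴴ * (SMat a c A Q f1 f2 S0 x)⁻¹ * Lam2 a c A Q f1 f2 x)

/-! The realisation. Here `L1`, `L2`, `S0` stand for `Λ₁(0)`, `Λ₂(0)`, `S(0)`, and `h` for the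
value `h(z)`. -/

/-- `h(z) = ζ(z) - z + c`. -/
def hFun (c : ℝ) (ζ : ℂ → ℂ) (z : ℂ) : ℂ := ζ z - z + c

/-- `𝒟 = ((a + h)/√2) I_p`. -/
def calD (p : ℕ) (a h : ℂ) : Matrix (Fin p) (Fin p) ℂ :=
  ((a + h) / ((Real.sqrt 2 : ℝ) : ℂ)) • 1

/-- `𝒞₁ = i (a - h)⁻¹ (Λ₁(0)^* + Λ₂(0)^*) S(0)⁻¹`. -/
def calC1 {n p : ℕ} (a h : ℂ) (L1 L2 : Matrix (Fin n) (Fin p) ℂ)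
    (S0 : Matrix (Fin n) (Fin n) ℂ) : Matrix (Fin p) (Fin n) ℂ :=
  (I * (a - h)⁻¹) • ((L1ᴴ + L2ᴴ) * S0⁻¹)

/-- `𝒞₂ = (i/√2) (Λ₁(0)^* - Λ₂(0)^*) S(0)⁻¹`. -/
def calC2 {n p : ℕ} (L1 L2 : Matrix (Fin n) (Fin p) ℂ)
    (S0 : Matrix (Fin n) (Fin n) ℂ) : Matrix (Fin p) (Fin n) ℂ :=
  (I / ((Real.sqrt 2 : ℝ) : ℂ)) • ((L1ᴴ - L2ᴴ) * S0⁻¹)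

/-- `ℬ = a Λ₁(0) + h Λ₂(0)`. -/
def calB {n p : ℕ} (a h : ℂ) (L1 L2 : Matrix (Fin n) (Fin p) ℂ) : Matrix (Fin n) (Fin p) ℂ :=
  a • L1 + h • L2

/-- `𝒜^× = A - ℬ 𝒞₁`. -/
def calAx {n p : ℕ} (a h : ℂ) (A : Matrix (Fin n) (Fin n) ℂ) (L1 L2 : Matrix (Fin n) (Fin p) ℂ)
    (S0 : Matrix (Fin n) (Fin n) ℂ) : Matrix (Fin n) (Fin n) ℂ :=
  A - calB a h L1 L2 * calC1 a h L1 L2 S0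

/-- `i √2 (a - h)⁻¹ (𝒟 + (𝒟 𝒞₁ - 𝒞₂) (𝒜^× - z I)⁻¹ ℬ)`. -/
def realisation {n p : ℕ} (a h z : ℂ) (A : Matrix (Fin n) (Fin n) ℂ)
    (L1 L2 : Matrix (Fin n) (Fin p) ℂ) (S0 : Matrix (Fin n) (Fin n) ℂ) :
    Matrix (Fin p) (Fin p) ℂ :=
  (I * ((Real.sqrt 2 : ℝ) : ℂ) * (a - h)⁻¹) •
    (calD p a h + (calD p a h * calC1 a h L1 L2 S0 - calC2 L1 L2 S0) *
      (calAx a h A L1 L2 S0 - z • 1)⁻¹ * calB a h L1 L2)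

end DiracWeyl

end

/-! Everything rests on the indefinite form `energy Y` = Re tr Y^*jY. Along a solution of a Dirac
system with spectral parameter z its derivative is -2 Im z times `mass Y` (`hasDerivAt_energy`).
Hence a solution whose energy stays nonnegative is square integrable (`integrableOn_mass`).
Conversely, a square integrable solution with zero initial energy is zero at the origin
(`eq_zero_of_integrableOn_mass`). Two Weyl functions give solutions whose difference starts at a
multiple of [D; D], where the energy vanishes; so D = 0. This is uniqueness, and existence needs one
solution of nonnegative energy with the right initial data (`isWeylFunction_iff`).

The system with potential a e^{2icx} has the explicit solution e^{iζx}[a e^{icx}; h e^{-icx}], of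
nonnegative energy because |h| < |a| on the upper half-plane (`normSq_h_lt`). If X' = -iΠjy and (A -
z)X = Πy, the Bäcklund–Darboux map y ↦ y - i jΠ^*S⁻¹X carries it to a solution of the transformed
system (`hasEntryDeriv_darboux`, `diracCoeff_transform`). By AS - SA^* = iΠjΠ^*, the energy grows by
2 Im z tr X^*S⁻¹X ≥ 0 (`energy_darboux`), so it remains nonnegative.

At x = 0, the image must be a multiple of Θ^*[I; -iφ(z)]. This linear condition is solved by G =
(𝒜^× - z)⁻¹ℬ and y(0) = [aU; hU] with U = I + 𝒞₁G, and reading off φ gives the realisation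
(`darboux_initial_value`). The same energy formula shows that 𝒜^× - z has trivial kernel
(`isUnit_calAx_sub`). -/

namespace DiracWeyl

/-! ### Entrywise derivatives of matrix functions -/

/-- The matrix function `F` has entrywise derivative `F'` within `s` at `x`. -/
def HasEntryDerivWithin {m n : Type*} (F : ℝ → Matrix m n ℂ) (F' : Matrix m n ℂ) (s : Set ℝ)
    (x : ℝ) : Prop :=
  ∀ k l, HasDerivWithinAt (fun t => F t k l) (F' k l) s x

/-- The matrix function `F` has entrywise derivative `F'` at `x`. -/
def HasEntryDeriv {m n : Type*} (F : ℝ → Matrix m n ℂ) (F' : Matrix m n ℂ) (x : ℝ) : Prop :=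
  ∀ k l, HasDerivAt (fun t => F t k l) (F' k l) x

section EntryDeriv

variable {k l m n : Type*} {F G : ℝ → Matrix m n ℂ} {F' G' : Matrix m n ℂ} {x : ℝ} {s : Set ℝ}

theorem HasEntryDeriv.within (hF : HasEntryDeriv F F' x) : HasEntryDerivWithin F F' s x :=
  fun i j => (hF i j).hasDerivWithinAt

theorem HasEntryDeriv.congr_deriv (hF : HasEntryDeriv F F' x) (h : F' = G') :
    HasEntryDeriv F G' x := h ▸ hF

theorem hasEntryDeriv_const (C : Matrix m n ℂ) : HasEntryDeriv (fun _ => C) 0 x :=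
  fun i j => hasDerivAt_const x (C i j)

theorem HasEntryDeriv.add (hF : HasEntryDeriv F F' x) (hG : HasEntryDeriv G G' x) :
    HasEntryDeriv (fun t => F t + G t) (F' + G') x :=
  fun i j => (hF i j).add (hG i j)

theorem HasEntryDeriv.sub (hF : HasEntryDeriv F F' x) (hG : HasEntryDeriv G G' x) :
    HasEntryDeriv (fun t => F t - G t) (F' - G') x :=
  fun i j => (hF i j).sub (hG i j)

theorem HasEntryDeriv.const_smul (c : ℂ) (hF : HasEntryDeriv F F' x) :
    HasEntryDeriv (fun t => c • F t) (c • F') x :=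
  fun i j => (hF i j).const_mul c

theorem HasEntryDeriv.smul {f : ℝ → ℂ} {f' : ℂ} (hf : HasDerivAt f f' x)
    (hF : HasEntryDeriv F F' x) :
    HasEntryDeriv (fun t => f t • F t) (f' • F x + f x • F') x :=
  fun i j => hf.mul (hF i j)

theorem HasEntryDerivWithin.mul [Fintype n] {H : ℝ → Matrix n l ℂ} {H' : Matrix n l ℂ}
    (hF : HasEntryDerivWithin F F' s x) (hH : HasEntryDerivWithin H H' s x) :
    HasEntryDerivWithin (fun t => F t * H t) (F' * H x + F x * H') s x := by
  intro i j
  have h := HasDerivWithinAt.fun_sum (u := Finset.univ) fun r _ => (hF i r).mul (hH r j)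
  simpa [Matrix.mul_apply, Matrix.add_apply, Finset.sum_add_distrib] using! h

theorem HasEntryDeriv.mul [Fintype n] {H : ℝ → Matrix n l ℂ} {H' : Matrix n l ℂ}
    (hF : HasEntryDeriv F F' x) (hH : HasEntryDeriv H H' x) :
    HasEntryDeriv (fun t => F t * H t) (F' * H x + F x * H') x := by
  intro i j
  have h := HasDerivAt.fun_sum (u := Finset.univ) fun r _ => (hF i r).mul (hH r j)
  simpa [Matrix.mul_apply, Matrix.add_apply, Finset.sum_add_distrib] using! h

theorem HasEntryDeriv.const_mul [Fintype m] (C : Matrix k m ℂ) (hF : HasEntryDeriv F F' x) :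
    HasEntryDeriv (fun t => C * F t) (C * F') x :=
  ((hasEntryDeriv_const C).mul hF).congr_deriv (by simp)

theorem HasEntryDeriv.mul_const [Fintype n] (hF : HasEntryDeriv F F' x) (C : Matrix n l ℂ) :
    HasEntryDeriv (fun t => F t * C) (F' * C) x :=
  (hF.mul (hasEntryDeriv_const C)).congr_deriv (by simp)

theorem HasEntryDerivWithin.mul_const [Fintype n] (hF : HasEntryDerivWithin F F' s x)
    (C : Matrix n l ℂ) : HasEntryDerivWithin (fun t => F t * C) (F' * C) s x := by
  have h := hF.mul ((hasEntryDeriv_const C).within (s := s))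
  simpa using h

theorem HasEntryDerivWithin.sub (hF : HasEntryDerivWithin F F' s x)
    (hG : HasEntryDerivWithin G G' s x) :
    HasEntryDerivWithin (fun t => F t - G t) (F' - G') s x :=
  fun i j => (hF i j).sub (hG i j)

theorem HasEntryDeriv.conjTranspose (hF : HasEntryDeriv F F' x) :
    HasEntryDeriv (fun t => (F t)ᴴ) F'ᴴ x :=
  fun i j => (hF j i).star

theorem HasEntryDeriv.fromCols {H : ℝ → Matrix m l ℂ} {H' : Matrix m l ℂ}
    (hF : HasEntryDeriv F F' x) (hH : HasEntryDeriv H H' x) :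
    HasEntryDeriv (fun t => Matrix.fromCols (F t) (H t)) (Matrix.fromCols F' H') x := by
  rintro i (j | j)
  · exact hF i j
  · exact hH i j

theorem HasEntryDeriv.fromRows {H : ℝ → Matrix l n ℂ} {H' : Matrix l n ℂ}
    (hF : HasEntryDeriv F F' x) (hH : HasEntryDeriv H H' x) :
    HasEntryDeriv (fun t => Matrix.fromRows (F t) (H t)) (Matrix.fromRows F' H') x := by
  rintro (i | i) j
  · exact hF i j
  · exact hH i j

theorem HasEntryDeriv.trace {F : ℝ → Matrix m m ℂ} {F' : Matrix m m ℂ} [Fintype m]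
    (hF : HasEntryDeriv F F' x) : HasDerivAt (fun t => (F t).trace) F'.trace x :=
  HasDerivAt.fun_sum fun i _ => hF i i

theorem HasEntryDeriv.continuousAt (hF : HasEntryDeriv F F' x) : ContinuousAt F x :=
  continuousAt_pi.2 fun i => continuousAt_pi.2 fun j => (hF i j).continuousAt

theorem eq_of_hasEntryDeriv_zero (hF : ∀ x, HasEntryDeriv F 0 x) (x y : ℝ) : F x = F y := by
  ext i j
  exact is_const_of_deriv_eq_zero (f := fun t => F t i j)
    (fun t => (hF t i j).differentiableAt) (fun t => (hF t i j).deriv) x y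

end EntryDeriv

/-! ### Passage between entrywise derivatives and derivatives in the operator norm. -/

section Norms

open scoped Matrix.Norms.Operator

variable {m n : Type*} [Fintype m] [Fintype n]

/-- Reading off an entry, as a continuous linear map. -/
noncomputable def entryCLM (i : m) (j : n) : Matrix m n ℂ →L[ℝ] ℂ :=
  LinearMap.toContinuousLinearMap
    { toFun := fun M => M i j, map_add' := fun _ _ => rfl, map_smul' := fun _ _ => rfl }

theorem hasEntryDeriv_of_hasDerivAt {F : ℝ → Matrix m n ℂ} {F' : Matrix m n ℂ} {x : ℝ}
    (hF : HasDerivAt F F' x) : HasEntryDeriv F F' x :=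
  fun i j => (entryCLM i j).hasFDerivAt.comp_hasDerivAt x hF

theorem HasEntryDerivWithin.hasDerivWithinAt {F : ℝ → Matrix m n ℂ}
    {F' : Matrix m n ℂ} {x : ℝ} {s : Set ℝ} (hF : HasEntryDerivWithin F F' s x) :
    HasDerivWithinAt F F' s x := by
  classical
  have key : ∀ M : Matrix m n ℂ,
      M = ∑ i, ∑ j, M i j • Matrix.single i j (1 : ℂ) := fun M => by
    conv_lhs => rw [matrix_eq_sum_single M]
    simp [Matrix.smul_single]
  have h : HasDerivWithinAt (fun t => ∑ i, ∑ j, F t i j • Matrix.single i j (1 : ℂ))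
      (∑ i, ∑ j, F' i j • Matrix.single i j (1 : ℂ)) s x :=
    HasDerivWithinAt.fun_sum fun i _ => HasDerivWithinAt.fun_sum fun j _ =>
      (hF i j).smul_const _
  rw [← key F'] at h
  exact h.congr_of_eventuallyEq (.of_forall fun t => key (F t)) (key (F x))

theorem HasEntryDeriv.hasDerivAt {F : ℝ → Matrix m n ℂ}
    {F' : Matrix m n ℂ} {x : ℝ} (hF : HasEntryDeriv F F' x) : HasDerivAt F F' x :=
  hasDerivWithinAt_univ.1 (hF.within (s := univ)).hasDerivWithinAt

variable [DecidableEq n]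

theorem hasEntryDeriv_exp_smul (c : ℂ) (Q : Matrix n n ℂ) (x : ℝ) :
    HasEntryDeriv (fun t : ℝ => NormedSpace.exp ((c * t) • Q))
      (c • (Q * NormedSpace.exp ((c * x) • Q))) x := by
  have h := hasDerivAt_exp_smul_const' (𝕂 := ℝ) (c • Q) x
  refine fun i j => ?_
  have h2 := hasEntryDeriv_of_hasDerivAt h i j
  have e : ∀ t : ℝ, (c * t) • Q = t • c • Q := fun t => by
    rw [mul_comm, mul_smul]; rfl
  simp only [e]
  simpa using! h2

theorem HasEntryDeriv.inv {F : ℝ → Matrix n n ℂ} {F' : Matrix n n ℂ} {x : ℝ}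
    (hF : HasEntryDeriv F F' x) (hu : IsUnit (F x)) :
    HasEntryDeriv (fun t => (F t)⁻¹) (-((F x)⁻¹ * F' * (F x)⁻¹)) x := by
  obtain ⟨u, hu⟩ := hu
  have h1 : HasFDerivAt Ring.inverse _ (u : Matrix n n ℂ) := hasFDerivAt_ringInverse (𝕜 := ℝ) u
  rw [hu] at h1
  have h2 := h1.comp_hasDerivAt x hF.hasDerivAt
  have h3 := hasEntryDeriv_of_hasDerivAt h2
  have e : ((u⁻¹ : (Matrix n n ℂ)ˣ) : Matrix n n ℂ) = (F x)⁻¹ := by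
    rw [← hu, Matrix.coe_units_inv]
  have e2 : (fun t => (F t)⁻¹) = Ring.inverse ∘ F :=
    funext fun t => Matrix.nonsing_inv_eq_ringInverse _
  rw [e2, ← e]
  exact h3

end Norms

/-! ### Linear differential equations -/

section LinearODE

variable {R : Type*} [NormedRing R] [NormedAlgebra ℝ R]

/-- The iterated integrals `W_{k+1}(t) = ∫₀ᵗ M W_k`, `W_0 = 1`. -/
noncomputable def iteratedIntegral (M : ℝ → R) : ℕ → ℝ → R
  | 0 => fun _ => 1
  | k + 1 => fun t => ∫ s in (0 : ℝ)..t, M s * iteratedIntegral M k s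

theorem continuous_iteratedIntegral {M : ℝ → R} (hM : Continuous M) (k : ℕ) :
    Continuous (iteratedIntegral M k) := by
  induction k with
  | zero => exact continuous_const
  | succ k ih =>
    exact intervalIntegral.continuous_primitive
      (fun a b => (hM.mul ih).intervalIntegrable a b) 0

theorem hasDerivAt_iteratedIntegral_succ [CompleteSpace R] {M : ℝ → R} (hM : Continuous M) (k : ℕ) (t : ℝ) :
    HasDerivAt (iteratedIntegral M (k + 1)) (M t * iteratedIntegral M k t) t :=
  ((hM.mul (continuous_iteratedIntegral hM k)).integral_hasStrictDerivAt 0 t).hasDerivAt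

/-- The factorial bound for the Picard series: each integration of |s|^k gains 1/(k+1). The factor
‖1‖ stays because the norm of the unit is not assumed to be 1. -/
theorem norm_iteratedIntegral_le {M : ℝ → R} (hM : Continuous M) {K T : ℝ} (hK : 0 ≤ K)
    (hMK : ∀ t, |t| ≤ T → ‖M t‖ ≤ K) (k : ℕ) {t : ℝ} (ht : |t| ≤ T) :
    ‖iteratedIntegral M k t‖ ≤ ‖(1 : R)‖ * ((K * |t|) ^ k / k.factorial) := by
  induction k generalizing t with
  | zero => simp [iteratedIntegral]
  | succ k ih =>
    set g : ℝ → ℝ := fun s => ‖(1 : R)‖ * K ^ (k + 1) / k.factorial * |s - 0| ^ k with hg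
    have hgc : Continuous g := by fun_prop
    have hmem : ∀ s ∈ uIoc 0 t, |s| ≤ T := fun s hs => by
      have := abs_sub_left_of_mem_uIcc (uIoc_subset_uIcc hs)
      simp only [sub_zero] at this
      exact this.trans ht
    have h1 : ‖iteratedIntegral M (k + 1) t‖ ≤ ∫ s in uIoc 0 t, g s := by
      refine (intervalIntegral.norm_integral_le_integral_norm_uIoc).trans ?_
      refine setIntegral_mono_on ?_ ?_ measurableSet_uIoc fun s hs => ?_
      · exact ((hM.mul (continuous_iteratedIntegral hM k)).norm.intervalIntegrable 0 t).def'
      · exact (hgc.intervalIntegrable 0 t).def'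
      · calc ‖M s * iteratedIntegral M k s‖ ≤ ‖M s‖ * ‖iteratedIntegral M k s‖ := norm_mul_le _ _
          _ ≤ K * (‖(1 : R)‖ * ((K * |s|) ^ k / k.factorial)) :=
            mul_le_mul (hMK s (hmem s hs)) (ih (hmem s hs)) (norm_nonneg _) hK
          _ = g s := by simp only [hg, sub_zero]; rw [mul_pow]; ring
    refine h1.trans (le_of_eq ?_)
    simp only [hg]
    rw [integral_const_mul, integral_pow_abs_sub_uIoc, sub_zero, Nat.factorial_succ, mul_pow]
    push_cast
    have : (k.factorial : ℝ) ≠ 0 := by positivity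
    field_simp

/-- A linear differential equation `W' = M W`, `W(0) = 1`, with continuous coefficient in a Banach
algebra has a global solution. -/
theorem exists_fundamentalSolution [CompleteSpace R] {M : ℝ → R} (hM : Continuous M) :
    ∃ W : ℝ → R, W 0 = 1 ∧ ∀ t, HasDerivAt W (M t * W t) t := by
  refine ⟨fun t => ∑' k, iteratedIntegral M k t, ?_, fun t => ?_⟩
  · refine (tsum_eq_single 0 ?_).trans ?_
    · rintro (_ | k) hk
      · exact absurd rfl hk
      · simp [iteratedIntegral]
    · rfl
  -- This T puts t in the interior of (-T, T), where M is bounded and termwise differentiation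
  -- applies.
  · set T := |t| + 1 with hT
    have hT0 : 0 < T := by positivity
    obtain ⟨K', hK'⟩ := isCompact_Icc.exists_bound_of_continuousOn (s := Icc (-T) T) hM.continuousOn
    have hK : 0 ≤ max K' 0 := le_max_right _ _
    set K := max K' 0 with hKdef
    have hMK : ∀ s, |s| ≤ T → ‖M s‖ ≤ K := fun s hs =>
      (hK' s (abs_le.1 hs)).trans (le_max_left _ _)
    have hb : ∀ k s, |s| ≤ T →
        ‖iteratedIntegral M k s‖ ≤ ‖(1 : R)‖ * ((K * T) ^ k / k.factorial) := fun k s hs => by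
      refine (norm_iteratedIntegral_le hM hK hMK k hs).trans ?_
      gcongr
    have hsum : Summable fun k : ℕ => ‖(1 : R)‖ * ((K * T) ^ k / k.factorial) :=
      (Real.summable_pow_div_factorial (K * T)).mul_left _
    have hs : ∀ s, |s| ≤ T → Summable fun k => iteratedIntegral M k s := fun s hs =>
      Summable.of_norm_bounded hsum fun k => hb k s hs
    have htT : |t| ≤ T := by simp [hT]
    have htm : t ∈ Ioo (-T) T := abs_lt.1 (by simp [hT])
    -- The series is shifted by one: the term of index 0 is constant, and differentiating term k + 1
    -- returns M times term k.
    have h := hasDerivAt_tsum_of_isPreconnected (u := fun k => K * (‖(1 : R)‖ * ((K * T) ^ k /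
        k.factorial))) (g := fun k => iteratedIntegral M (k + 1))
      (g' := fun k s => M s * iteratedIntegral M k s) (hsum.mul_left K) isOpen_Ioo
      isPreconnected_Ioo (fun k s _ => hasDerivAt_iteratedIntegral_succ hM k s)
      (fun k s hs => (norm_mul_le _ _).trans
        (mul_le_mul (hMK s (abs_lt.2 hs).le) (hb k s (abs_lt.2 hs).le) (norm_nonneg _) hK))
      htm ((summable_nat_add_iff 1).2 (hs t htT)) htm
    rw [(hs t htT).tsum_mul_left] at h
    refine (h.const_add 1).congr_of_eventuallyEq ?_
    filter_upwards [isOpen_Ioo.mem_nhds htm] with s hs'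
    rw [(hs s (abs_lt.2 hs').le).tsum_eq_zero_add]
    rfl

end LinearODE

section MatrixODE

open scoped Matrix.Norms.Operator

variable {m n : Type*} [Fintype m] [Fintype n]

theorem exists_matrix_fundamentalSolution [DecidableEq n] {M : ℝ → Matrix n n ℂ}
    (hM : ContinuousOn M (Ici 0)) :
    ∃ W : ℝ → Matrix n n ℂ, W 0 = 1 ∧ ∀ x, 0 ≤ x → HasEntryDeriv W (M x * W x) x := by
  -- The coefficient is frozen at its value at 0 on the negative axis, so the solution has a
  -- two-sided derivative at the origin as well.
  obtain ⟨W, h0, hW⟩ := exists_fundamentalSolution (M := fun t => M (max t 0))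
    (hM.comp_continuous (by fun_prop) fun t => le_max_right t 0)
  refine ⟨W, h0, fun x hx => ?_⟩
  have := hasEntryDeriv_of_hasDerivAt (hW x)
  rwa [max_eq_left hx] at this

/-- Grönwall on [0, x], where the continuous coefficient is bounded. -/
theorem eq_zero_of_linear_ode {M : ℝ → Matrix m m ℂ} (hM : ContinuousOn M (Ici 0))
    {Y : ℝ → Matrix m n ℂ} (hY : ∀ x, 0 ≤ x → HasEntryDerivWithin Y (M x * Y x) (Ici 0) x)
    (h0 : Y 0 = 0) {x : ℝ} (hx : 0 ≤ x) : Y x = 0 := by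
  obtain ⟨K, hK⟩ := isCompact_Icc.exists_bound_of_continuousOn (s := Icc 0 x)
    (hM.mono Icc_subset_Ici_self)
  have hY' := fun t (ht : 0 ≤ t) => (hY t ht).hasDerivWithinAt
  refine eq_zero_of_abs_deriv_le_mul_abs_self_of_eq_zero_right (f := Y)
    (f' := fun t => M t * Y t) (K := K) (a := 0) (b := x)
    (fun t ht => (hY' t ht.1).continuousWithinAt.mono Icc_subset_Ici_self)
    (fun t ht => (hY' t ht.1).mono (Ici_subset_Ici.2 ht.1)) h0 (fun t ht => ?_) x ⟨hx, le_rfl⟩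
  exact (Matrix.linfty_opNorm_mul _ _).trans
    (mul_le_mul_of_nonneg_right (hK t ⟨ht.1, ht.2.le⟩) (norm_nonneg _))

theorem eqOn_of_linear_ode {M : ℝ → Matrix m m ℂ} (hM : ContinuousOn M (Ici 0))
    {Y Z : ℝ → Matrix m n ℂ} (hY : ∀ x, 0 ≤ x → HasEntryDerivWithin Y (M x * Y x) (Ici 0) x)
    (hZ : ∀ x, 0 ≤ x → HasEntryDerivWithin Z (M x * Z x) (Ici 0) x)
    (h0 : Y 0 = Z 0) {x : ℝ} (hx : 0 ≤ x) : Y x = Z x := by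
  refine sub_eq_zero.1 (eq_zero_of_linear_ode hM (Y := fun t => Y t - Z t) (fun t ht => ?_)
    (sub_eq_zero.2 h0) hx)
  rw [Matrix.mul_sub]
  exact (hY t ht).sub (hZ t ht)

end MatrixODE

/-! ### The Dirac system and its energy identity -/

section Dirac

variable {p : ℕ} {q : Type*} [Fintype q]

theorem jMat_mul_jMat (p : ℕ) : jMat p * jMat p = 1 := by
  simp [jMat, fromBlocks_multiply]

theorem jMat_conjTranspose (p : ℕ) : (jMat p)ᴴ = jMat p := by
  simp [jMat, fromBlocks_conjTranspose]

theorem jMat_mul_cancel_left {l : Type*} (M : Matrix (Fin p ⊕ Fin p) l ℂ) :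
    jMat p * (jMat p * M) = M := by
  rw [← Matrix.mul_assoc, jMat_mul_jMat, Matrix.one_mul]

theorem potMat_conjTranspose (v : Matrix (Fin p) (Fin p) ℂ) : (potMat v)ᴴ = potMat v := by
  simp [potMat, fromBlocks_conjTranspose]

theorem jMat_mul_potMat (v : Matrix (Fin p) (Fin p) ℂ) :
    jMat p * potMat v = -(potMat v * jMat p) := by
  simp [jMat, potMat, fromBlocks_multiply, fromBlocks_neg]

/-- The coefficient `i (z j + j V)` of the Dirac system. -/
noncomputable def diracCoeff (z : ℂ) (v : Matrix (Fin p) (Fin p) ℂ) :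
    Matrix (Fin p ⊕ Fin p) (Fin p ⊕ Fin p) ℂ :=
  I • (z • jMat p + jMat p * potMat v)

/-- Since j·jV = V is Hermitian, the potential drops out; what is left is i(z - z̄) = -2 Im z. This
is the source of the energy identity. -/
theorem diracCoeff_dissipation (z : ℂ) (v : Matrix (Fin p) (Fin p) ℂ) :
    (diracCoeff z v)ᴴ * jMat p + jMat p * diracCoeff z v = (-(2 * z.im : ℂ)) • 1 := by
  have h : jMat p * (jMat p * potMat v) = potMat v := jMat_mul_cancel_left _
  simp only [diracCoeff, conjTranspose_smul, conjTranspose_add, conjTranspose_mul,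
    jMat_conjTranspose, potMat_conjTranspose, Matrix.smul_mul, Matrix.mul_smul, Matrix.add_mul,
    Matrix.mul_add, jMat_mul_jMat, Matrix.mul_assoc, h, Matrix.mul_one]
  have hz : z = z.re + z.im * I := (re_add_im z).symm
  match_scalars
  · simp only [star_def, mul_one]
    rw [conj_I]
    conv_lhs => rw [hz]
    simp only [map_add, map_mul, conj_ofReal, conj_I]
    linear_combination 2 * (z.im : ℂ) * I_mul_I
  · simp

/-- The indefinite form `tr Y^* j Y`. -/
noncomputable def energy (Y : Matrix (Fin p ⊕ Fin p) q ℂ) : ℝ := (trace (Yᴴ * (jMat p * Y))).re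

/-- The squared Frobenius norm `tr Y^* Y`. -/
noncomputable def mass {m : Type*} [Fintype m] (Y : Matrix m q ℂ) : ℝ := (trace (Yᴴ * Y)).re

theorem mass_eq_sum {m : Type*} [Fintype m] (Y : Matrix m q ℂ) :
    mass Y = ∑ l, ∑ k, ‖Y k l‖ ^ 2 := by
  simp only [mass, trace, diag_apply, mul_apply, conjTranspose_apply, re_sum]
  refine Finset.sum_congr rfl fun l _ => Finset.sum_congr rfl fun k _ => ?_
  rw [star_def, ← normSq_eq_conj_mul_self, ofReal_re, normSq_eq_norm_sq]

theorem mass_nonneg {m : Type*} [Fintype m] (Y : Matrix m q ℂ) : 0 ≤ mass Y := by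
  rw [mass_eq_sum]; positivity

theorem eq_zero_of_mass_eq_zero {m : Type*} [Fintype m] {Y : Matrix m q ℂ} (h : mass Y = 0) :
    Y = 0 := by
  rw [mass_eq_sum, Finset.sum_eq_zero_iff_of_nonneg fun _ _ => by positivity] at h
  ext k l
  have := h l (Finset.mem_univ _)
  rw [Finset.sum_eq_zero_iff_of_nonneg fun _ _ => by positivity] at this
  simpa using this k (Finset.mem_univ _)

theorem norm_sq_le_mass {m : Type*} [Fintype m] (Y : Matrix m q ℂ) (k : m) (l : q) :
    ‖Y k l‖ ^ 2 ≤ mass Y := by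
  rw [mass_eq_sum]
  refine le_trans ?_ (Finset.single_le_sum (f := fun l => ∑ k, ‖Y k l‖ ^ 2)
    (fun _ _ => by positivity) (Finset.mem_univ l))
  exact Finset.single_le_sum (f := fun k => ‖Y k l‖ ^ 2)
    (fun _ _ => by positivity) (Finset.mem_univ k)

theorem mass_sub_le {m : Type*} [Fintype m] (Y Z : Matrix m q ℂ) :
    mass (Y - Z) ≤ 2 * mass Y + 2 * mass Z := by
  simp only [mass_eq_sum, Finset.mul_sum, ← Finset.sum_add_distrib]
  refine Finset.sum_le_sum fun l _ => Finset.sum_le_sum fun k _ => ?_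
  have h := norm_sub_le (Y k l) (Z k l)
  rw [Matrix.sub_apply]
  nlinarith [norm_nonneg (Y k l - Z k l), sq_nonneg (‖Y k l‖ - ‖Z k l‖)]

theorem energy_eq_sum (Y : Matrix (Fin p ⊕ Fin p) q ℂ) :
    energy Y = ∑ l, (∑ k, ‖Y (.inl k) l‖ ^ 2 - ∑ k, ‖Y (.inr k) l‖ ^ 2) := by
  have h0 : ∀ w : ℂ, (star w * w).re = ‖w‖ ^ 2 := fun w => by
    rw [star_def, ← normSq_eq_conj_mul_self, ofReal_re, normSq_eq_norm_sq]
  have h1 : ∀ k l, (jMat p * Y) (.inl k) l = Y (.inl k) l := fun k l => by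
    simp [jMat, mul_apply, fromBlocks, Matrix.one_apply]
  have h2 : ∀ k l, (jMat p * Y) (.inr k) l = -Y (.inr k) l := fun k l => by
    simp [jMat, mul_apply, fromBlocks, Matrix.one_apply]
  simp only [energy, trace, diag_apply, mul_apply (M := Yᴴ), conjTranspose_apply, re_sum,
    Fintype.sum_sum_type, h1, h2, mul_neg, Finset.sum_neg_distrib, ← sub_eq_add_neg,
    sub_re, h0]

theorem neg_energy_le_mass (Y : Matrix (Fin p ⊕ Fin p) q ℂ) : -energy Y ≤ mass Y := by
  rw [energy_eq_sum, mass_eq_sum, ← Finset.sum_neg_distrib]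
  refine Finset.sum_le_sum fun l _ => ?_
  rw [Fintype.sum_sum_type]
  have : 0 ≤ ∑ k, ‖Y (.inl k) l‖ ^ 2 := by positivity
  linarith

theorem hasDerivAt_energy {z : ℂ} {v : Matrix (Fin p) (Fin p) ℂ}
    {Y : ℝ → Matrix (Fin p ⊕ Fin p) q ℂ} {x : ℝ}
    (hY : HasEntryDeriv Y (diracCoeff z v * Y x) x) :
    HasDerivAt (fun t => energy (Y t)) (-(2 * z.im) * mass (Y x)) x := by
  have h := (hY.conjTranspose.mul (hY.const_mul (jMat p))).trace
  have e : (diracCoeff z v * Y x)ᴴ * (jMat p * Y x) + (Y x)ᴴ * (jMat p * (diracCoeff z v * Y x))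
      = (-(2 * z.im : ℂ)) • ((Y x)ᴴ * Y x) := by
    calc _ = (Y x)ᴴ * (((diracCoeff z v)ᴴ * jMat p + jMat p * diracCoeff z v) * Y x) := by
          simp only [conjTranspose_mul, Matrix.add_mul, Matrix.mul_add, Matrix.mul_assoc]
      _ = _ := by
          rw [diracCoeff_dissipation, Matrix.smul_mul, Matrix.one_mul, Matrix.mul_smul]
  rw [e, trace_smul] at h
  have h2 := reCLM.hasFDerivAt.comp_hasDerivAt _ h
  simpa [energy, mass] using! h2

theorem continuousOn_mass {m : Type*} [Fintype m] {Y : ℝ → Matrix m q ℂ} {s : Set ℝ}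
    (hY : ContinuousOn Y s) : ContinuousOn (fun x => mass (Y x)) s := by
  have : Continuous fun M : Matrix m q ℂ => mass M := by
    simp only [mass_eq_sum]
    fun_prop
  exact this.comp_continuousOn hY

/-- A solution with nonnegative energy is square integrable. -/
theorem integrableOn_mass {z : ℂ} (hz : 0 < z.im) {v : ℝ → Matrix (Fin p) (Fin p) ℂ}
    {Y : ℝ → Matrix (Fin p ⊕ Fin p) q ℂ}
    (hY : ∀ x, 0 ≤ x → HasEntryDeriv Y (diracCoeff z (v x) * Y x) x)
    (hE : ∀ x, 0 ≤ x → 0 ≤ energy (Y x)) : IntegrableOn (fun x => mass (Y x)) (Ioi 0) := by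
  have hc : ContinuousOn (fun x => mass (Y x)) (Ici 0) :=
    continuousOn_mass fun x hx => (hY x hx).continuousAt.continuousWithinAt
  -- The bound is the integrated energy identity: 2 Im z ∫₀ᵀ mass = energy(0) - energy(T) ≤
  -- energy(0).
  refine integrableOn_Ioi_of_intervalIntegral_norm_bounded (energy (Y 0) / (2 * z.im)) 0
    (b := fun x : ℝ => x) (l := Filter.atTop) (fun T => ?_) Filter.tendsto_id ?_
  · exact (hc.mono Icc_subset_Ici_self).integrableOn_Icc.mono_set Ioc_subset_Icc_self
  · filter_upwards [Filter.eventually_ge_atTop 0] with T hT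
    have h1 : ∫ x in (0 : ℝ)..T, -(2 * z.im) * mass (Y x) = energy (Y T) - energy (Y 0) := by
      refine intervalIntegral.integral_eq_sub_of_hasDerivAt (f := fun x => energy (Y x)) ?_ ?_
      · intro x hx
        rw [uIcc_of_le hT] at hx
        exact hasDerivAt_energy (hY x hx.1)
      · refine ContinuousOn.intervalIntegrable ?_
        rw [uIcc_of_le hT]
        exact continuousOn_const.mul (hc.mono Icc_subset_Ici_self)
    rw [intervalIntegral.integral_const_mul] at h1
    simp only [Real.norm_of_nonneg (mass_nonneg _)]
    rw [le_div_iff₀ (by positivity)]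
    linarith [hE T hT]

/-- A square integrable solution with zero initial energy vanishes at the origin. -/
theorem eq_zero_of_integrableOn_mass {z : ℂ} (hz : 0 < z.im)
    {v : ℝ → Matrix (Fin p) (Fin p) ℂ} {Y : ℝ → Matrix (Fin p ⊕ Fin p) q ℂ}
    (hY : ∀ x, 0 ≤ x → HasEntryDeriv Y (diracCoeff z (v x) * Y x) x)
    (hE : energy (Y 0) = 0) (hint : IntegrableOn (fun x => mass (Y x)) (Ioi 0)) : Y 0 = 0 := by
  have hanti : AntitoneOn (fun x => energy (Y x)) (Ici 0) := by
    refine antitoneOn_of_deriv_nonpos (convex_Ici 0)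
      (fun x hx => (hasDerivAt_energy (hY x hx)).continuousAt.continuousWithinAt)
      (fun x hx => (hasDerivAt_energy (hY x (interior_subset hx))).differentiableAt.differentiableWithinAt)
      fun x hx => ?_
    rw [(hasDerivAt_energy (hY x (interior_subset hx))).deriv]
    have := mass_nonneg (Y x)
    nlinarith
  have hzero : ∀ x, 0 ≤ x → energy (Y x) = 0 := by
    intro x hx
    refine le_antisymm (hE ▸ hanti (mem_Ici.2 le_rfl) hx hx) ?_
    -- Energy decreases, so a negative value persists; mass then stays above a positive constant on
    -- a half-line, against integrability.
    by_contra! hneg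
    have h1 : IntegrableOn (fun _ : ℝ => -energy (Y x)) (Ioi x) := by
      refine Integrable.mono' (hint.mono_set (Ioi_subset_Ioi hx)) aestronglyMeasurable_const ?_
      refine (ae_restrict_iff' measurableSet_Ioi).2 (.of_forall fun t ht => ?_)
      rw [Real.norm_of_nonneg (by linarith)]
      have h2 : energy (Y t) ≤ energy (Y x) := hanti hx (hx.trans (le_of_lt ht)) (le_of_lt ht)
      linarith [neg_energy_le_mass (Y t)]
    rw [integrableOn_const_iff] at h1
    rcases h1 with h1 | h1
    · simp at h1
      linarith
    · simp at h1
  -- The energy vanishes on the half-line, so its one-sided derivative at 0, which is -2 Im z times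
  -- the mass of `Y 0`, vanishes too.
  have h0 := (hasDerivAt_energy (hY 0 le_rfl)).hasDerivWithinAt (s := Ici 0)
  have h1 : HasDerivWithinAt (fun x => energy (Y x)) 0 (Ici 0) 0 :=
    (hasDerivWithinAt_const (0 : ℝ) (Ici 0) (0 : ℝ)).congr (fun x hx => hzero x hx)
      (hzero 0 le_rfl)
  have h2 := (uniqueDiffOn_Ici (0 : ℝ) 0 (mem_Ici.2 le_rfl)).eq_deriv _ h0 h1
  refine eq_zero_of_mass_eq_zero ?_
  have : -(2 * z.im) ≠ 0 := by linarith
  exact (mul_eq_zero.1 h2).resolve_left this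

end Dirac

/-! ### The generalised Bäcklund–Darboux transformation -/

section Darboux

variable {n p : ℕ} {A : Matrix (Fin n) (Fin n) ℂ}

theorem commutator_inv {S : Matrix (Fin n) (Fin n) ℂ}
    {P : Matrix (Fin n) (Fin p ⊕ Fin p) ℂ} (hS : S.PosDef)
    (hid : A * S - S * Aᴴ = I • (P * jMat p * Pᴴ)) :
    Aᴴ * S⁻¹ = S⁻¹ * A - I • (S⁻¹ * (P * (jMat p * (Pᴴ * S⁻¹)))) := by
  have hu := (Matrix.isUnit_iff_isUnit_det _).1 hS.isUnit
  have h := congrArg (fun M => S⁻¹ * (M * S⁻¹)) hid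
  simp only [Matrix.sub_mul, Matrix.mul_sub, Matrix.smul_mul, Matrix.mul_smul, Matrix.mul_assoc,
    Matrix.mul_nonsing_inv _ hu, Matrix.mul_one, nonsing_inv_mul_cancel_left _ _ hu] at h
  rw [← h]
  abel

/-- The transformed solution `y - i j Π^* S⁻¹ X`. -/
noncomputable def darboux {q : Type*} (P : Matrix (Fin n) (Fin p ⊕ Fin p) ℂ)
    (S : Matrix (Fin n) (Fin n) ℂ) (y : Matrix (Fin p ⊕ Fin p) q ℂ) (X : Matrix (Fin n) q ℂ) :
    Matrix (Fin p ⊕ Fin p) q ℂ :=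
  y - I • (jMat p * (Pᴴ * (S⁻¹ * X)))

/-- In the expanded form, Πy is replaced by (A - z)X and S⁻¹ΠjΠ^*S⁻¹ by the commutator of A with
S⁻¹. All terms in A cancel, and the terms in z and z̄ leave 2 Im z X^*S⁻¹X. -/
theorem darboux_form {q : Type*} [Fintype q] {S : Matrix (Fin n) (Fin n) ℂ}
    {P : Matrix (Fin n) (Fin p ⊕ Fin p) ℂ} (hS : S.PosDef)
    (hid : A * S - S * Aᴴ = I • (P * jMat p * Pᴴ)) {z : ℂ} {y : Matrix (Fin p ⊕ Fin p) q ℂ}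
    {X : Matrix (Fin n) q ℂ} (hX : A * X = z • X + P * y) :
    (darboux P S y X)ᴴ * (jMat p * darboux P S y X) =
      yᴴ * (jMat p * y) + (2 * z.im : ℂ) • (Xᴴ * (S⁻¹ * X)) := by
  have hSi : (S⁻¹)ᴴ = S⁻¹ := hS.inv.1
  have h1 := commutator_inv hS hid
  have h2 : yᴴ * Pᴴ = Xᴴ * Aᴴ - star z • Xᴴ := by
    have := congrArg conjTranspose hX
    simp only [conjTranspose_mul, conjTranspose_add, conjTranspose_smul] at this
    rw [this]; abel
  have h3 : P * y = A * X - z • X := by rw [hX]; abel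
  have h4 : Xᴴ * (S⁻¹ * (P * (jMat p * (Pᴴ * (S⁻¹ * X))))) =
      -I • (Xᴴ * (S⁻¹ * (A * X))) + I • (Xᴴ * (Aᴴ * (S⁻¹ * X))) := by
    have := congrArg (fun M => I • (Xᴴ * (M * X))) h1
    simp only [Matrix.sub_mul, Matrix.mul_sub, Matrix.smul_mul, Matrix.mul_smul,
      Matrix.mul_assoc, smul_sub, smul_smul, I_mul_I] at this
    rw [this]; module
  have h5 : yᴴ * (Pᴴ * (S⁻¹ * X)) = Xᴴ * (Aᴴ * (S⁻¹ * X)) - star z • (Xᴴ * (S⁻¹ * X)) := by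
    rw [← Matrix.mul_assoc, h2]
    simp only [Matrix.sub_mul, Matrix.smul_mul, Matrix.mul_assoc]
  simp only [darboux, conjTranspose_sub, conjTranspose_smul, conjTranspose_mul,
    conjTranspose_conjTranspose, jMat_conjTranspose, hSi, Matrix.sub_mul, Matrix.mul_sub,
    Matrix.smul_mul, Matrix.mul_smul, Matrix.mul_assoc, jMat_mul_cancel_left, h3, h4, h5, star_def,
    conj_I]
  have hz : z = z.re + z.im * I := (re_add_im z).symm
  have hz' : (starRingEnd ℂ) z = z.re - z.im * I := by
    conv_lhs => rw [hz]
    simp only [map_add, map_mul, conj_ofReal, conj_I]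
    ring
  match_scalars
  · simp
  · linear_combination I * I_mul_I
  · rw [hz']
    linear_combination (-2 * (z.im : ℂ)) * I_mul_I - I * hz
  · linear_combination (-I) * I_mul_I

theorem conj_jMat_offDiag (R : Matrix (Fin p ⊕ Fin p) (Fin p ⊕ Fin p) ℂ)
    {R11 R12 R21 R22 : Matrix (Fin p) (Fin p) ℂ} (hR : R = fromBlocks R11 R12 R21 R22) :
    R - jMat p * R * jMat p = fromBlocks 0 ((2 : ℂ) • R12) ((2 : ℂ) • R21) 0 := by
  subst hR
  simp only [jMat, fromBlocks_multiply, sub_eq_add_neg, fromBlocks_neg, fromBlocks_add]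
  simp [two_smul]

/-- For R = Π^*S⁻¹Π, the difference R - jRj keeps only the doubled off-diagonal blocks. The factor
-2i in the new potential is what makes ij times its increment equal to them. -/
theorem diracCoeff_transform (z : ℂ) (v : Matrix (Fin p) (Fin p) ℂ)
    {S : Matrix (Fin n) (Fin n) ℂ} (hS : S.PosDef) (L1 L2 : Matrix (Fin n) (Fin p) ℂ) :
    diracCoeff z (v - (2 * I) • (L1ᴴ * S⁻¹ * L2)) = diracCoeff z v +
      ((fromCols L1 L2)ᴴ * (S⁻¹ * fromCols L1 L2) -
        jMat p * ((fromCols L1 L2)ᴴ * (S⁻¹ * fromCols L1 L2)) * jMat p) := by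
  have hSi : (S⁻¹)ᴴ = S⁻¹ := hS.inv.1
  rw [conj_jMat_offDiag (R11 := L1ᴴ * (S⁻¹ * L1)) (R12 := L1ᴴ * (S⁻¹ * L2))
    (R21 := L2ᴴ * (S⁻¹ * L1)) (R22 := L2ᴴ * (S⁻¹ * L2))]
  · simp only [diracCoeff, jMat, potMat, fromBlocks_multiply, fromBlocks_smul, fromBlocks_add,
      conjTranspose_sub, conjTranspose_smul, conjTranspose_mul, conjTranspose_conjTranspose, hSi,
      Matrix.mul_assoc]
    simp only [fromBlocks_inj]
    refine ⟨by simp, ?_, ?_, by simp⟩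
    · simp only [Matrix.one_mul, Matrix.mul_zero]
      match_scalars
      · simp
      · linear_combination (-2) * I_mul_I
    · simp only [Matrix.neg_mul, Matrix.one_mul, Matrix.mul_zero, star_mul',
        star_def, conj_I, star_ofNat]
      match_scalars
      · simp
      · simp
        linear_combination (-2) * I_mul_I
  · rw [mul_fromCols, conjTranspose_fromCols_eq_fromRows_conjTranspose, fromRows_mul_fromCols]

variable {P : ℝ → Matrix (Fin n) (Fin p ⊕ Fin p) ℂ} {S : ℝ → Matrix (Fin n) (Fin n) ℂ}
  {v : ℝ → Matrix (Fin p) (Fin p) ℂ}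

/-- Both sides have derivative AΠΠ^* - ΠΠ^*A^*: in (ΠjΠ^*)' the two potential terms are ΠjVjΠ^* with
opposite signs. The identity therefore propagates from x = 0. -/
theorem commutator_identity
    (hP : ∀ x, HasEntryDeriv P (-I • (A * P x * jMat p + P x * (jMat p * potMat (v x)))) x)
    (hS : ∀ x, HasEntryDeriv S (P x * (P x)ᴴ) x)
    (hid : A * S 0 - S 0 * Aᴴ = I • (P 0 * jMat p * (P 0)ᴴ)) (x : ℝ) :
    A * S x - S x * Aᴴ = I • (P x * jMat p * (P x)ᴴ) := by
  have h : ∀ x, HasEntryDeriv (fun t => A * S t - S t * Aᴴ - I • (P t * jMat p * (P t)ᴴ)) 0 x := by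
    intro x
    refine ((((hS x).const_mul A).sub ((hS x).mul_const Aᴴ)).sub
      ((((hP x).mul_const (jMat p)).mul (hP x).conjTranspose).const_smul I)).congr_deriv ?_
    have hjV : jMat p * (potMat (v x) * jMat p) = -potMat (v x) := by
      rw [← neg_eq_iff_eq_neg, ← Matrix.mul_neg, ← jMat_mul_potMat, jMat_mul_cancel_left]
    simp only [conjTranspose_add, conjTranspose_smul, conjTranspose_mul, jMat_conjTranspose,
      potMat_conjTranspose, Matrix.add_mul, Matrix.mul_add, Matrix.smul_mul, Matrix.mul_smul,
      Matrix.mul_assoc, jMat_mul_cancel_left, star_neg, star_def, conj_I, neg_neg, smul_add]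
    rw [← Matrix.mul_assoc (potMat (v x)) (jMat p) (P x)ᴴ,
      ← Matrix.mul_assoc (jMat p) _ (P x)ᴴ, hjV]
    simp only [Matrix.neg_mul, Matrix.mul_neg]
    match_scalars <;> first | ring1 | linear_combination I_mul_I | linear_combination (-1 : ℂ) * I_mul_I
  have := eq_of_hasEntryDeriv_zero h x 0
  rw [hid, sub_self] at this
  exact sub_eq_zero.1 this

/-- Each quadratic form of S is nondecreasing because S' = ΠΠ^* is positive semidefinite; S stays
Hermitian because S^* - S is constant. -/
theorem posDef_of_hasEntryDeriv (hS : ∀ x, HasEntryDeriv S (P x * (P x)ᴴ) x) (h0 : (S 0).PosDef)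
    {x : ℝ} (hx : 0 ≤ x) : (S x).PosDef := by
  have hherm : (S x)ᴴ = S x := by
    have h : ∀ x, HasEntryDeriv (fun t => (S t)ᴴ - S t) 0 x := fun x =>
      ((hS x).conjTranspose.sub (hS x)).congr_deriv (by simp [conjTranspose_mul])
    have := eq_of_hasEntryDeriv_zero h x 0
    rw [h0.1.eq, sub_self] at this
    exact sub_eq_zero.1 this
  refine Matrix.PosDef.of_dotProduct_mulVec_pos hherm fun w hw => ?_
  have hd : ∀ t, HasDerivAt (fun t => (star w ⬝ᵥ (S t *ᵥ w)).re)
      (star w ⬝ᵥ ((P t * (P t)ᴴ) *ᵥ w)).re t := by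
    intro t
    have h := (((hS t).mul_const (replicateCol Unit w)).const_mul (replicateCol Unit w)ᴴ) () ()
    have h2 := reCLM.hasFDerivAt.comp_hasDerivAt _ h
    exact h2
  have hmono : Monotone fun t => (star w ⬝ᵥ (S t *ᵥ w)).re := by
    refine monotone_of_deriv_nonneg (fun t => (hd t).differentiableAt) fun t => ?_
    rw [(hd t).deriv]
    exact (Complex.nonneg_iff.1
      ((posSemidef_self_mul_conjTranspose (P t)).dotProduct_mulVec_nonneg w)).1
  have h1 := (Complex.pos_iff.1 (h0.dotProduct_mulVec_pos hw)).1
  refine Complex.pos_iff.2 ⟨h1.trans_le (hmono hx), ?_⟩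
  exact (Matrix.IsHermitian.im_star_dotProduct_mulVec_self (𝕜 := ℂ) hherm w).symm

/-- Differentiating Π^* produces A^*S⁻¹X. The commutator identity turns it into S⁻¹AX plus a ΠjΠ^*
term, and AX = zX + Πy removes A; the remaining terms factor through the transformed solution. -/
theorem hasEntryDeriv_darboux {q : Type*} [Fintype q] {x : ℝ} {z : ℂ}
    {y : ℝ → Matrix (Fin p ⊕ Fin p) q ℂ} {X : ℝ → Matrix (Fin n) q ℂ}
    (hP : HasEntryDeriv P (-I • (A * P x * jMat p + P x * (jMat p * potMat (v x)))) x)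
    (hS : HasEntryDeriv S (P x * (P x)ᴴ) x) (hpos : (S x).PosDef)
    (hid : A * S x - S x * Aᴴ = I • (P x * jMat p * (P x)ᴴ))
    (hy : HasEntryDeriv y (diracCoeff z (v x) * y x) x)
    (hX : HasEntryDeriv X (-I • (P x * (jMat p * y x))) x)
    (hAX : A * X x = z • X x + P x * y x) :
    HasEntryDeriv (fun t => darboux (P t) (S t) (y t) (X t))
      ((diracCoeff z (v x) + ((P x)ᴴ * ((S x)⁻¹ * P x) -
        jMat p * ((P x)ᴴ * ((S x)⁻¹ * P x)) * jMat p)) * darboux (P x) (S x) (y x) (X x)) x := by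
  refine (hy.sub (((hP.conjTranspose.mul ((hS.inv hpos.isUnit).mul hX)).const_mul
    (jMat p)).const_smul I)).congr_deriv ?_
  have hA := commutator_inv hpos hid
  have hA' : Aᴴ * ((S x)⁻¹ * X x) = (S x)⁻¹ * (z • X x + P x * y x) -
      I • ((S x)⁻¹ * (P x * (jMat p * ((P x)ᴴ * ((S x)⁻¹ * X x))))) := by
    rw [← Matrix.mul_assoc, hA, Matrix.sub_mul, Matrix.mul_assoc, hAX]
    simp only [Matrix.smul_mul, Matrix.mul_assoc]
  have hjV : ∀ M : Matrix (Fin p ⊕ Fin p) q ℂ,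
      potMat (v x) * (jMat p * M) = -(jMat p * (potMat (v x) * M)) := fun M => by
    rw [← Matrix.mul_assoc, ← Matrix.mul_assoc (jMat p), jMat_mul_potMat, Matrix.neg_mul, neg_neg]
  simp only [darboux, diracCoeff, conjTranspose_add, conjTranspose_smul, conjTranspose_mul,
    jMat_conjTranspose, potMat_conjTranspose, Matrix.add_mul, Matrix.mul_add, Matrix.sub_mul,
    Matrix.mul_sub, Matrix.smul_mul, Matrix.mul_smul, Matrix.neg_mul, Matrix.mul_neg,
    Matrix.mul_assoc, jMat_mul_cancel_left, hjV, hA', star_neg, star_def, conj_I, neg_neg]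
  match_scalars
  all_goals ring_nf
  all_goals simp only [I_sq, I_pow_three]
  all_goals ring_nf

end Darboux

/-! ### The initial system with potential `a e^{2icx} I_p` -/

section Initial

variable {n p : ℕ} {a : ℂ} {c : ℝ} {A Q : Matrix (Fin n) (Fin n) ℂ}
  {f1 f2 : Matrix (Fin n) (Fin p) ℂ}

theorem hasDerivAt_cexp_mul_ofReal (b : ℂ) (x : ℝ) :
    HasDerivAt (fun t : ℝ => cexp (b * t)) (b * cexp (b * x)) x := by
  have h := ((hasDerivAt_id (x : ℂ)).const_mul b).cexp.comp_ofReal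
  simpa [mul_comm] using! h

theorem commute_exp_smul {B Q : Matrix (Fin n) (Fin n) ℂ} (h : B * Q = Q * B) (b : ℂ) :
    B * NormedSpace.exp (b • Q) = NormedSpace.exp (b • Q) * B :=
  ((show Commute B Q from h).smul_right b).exp_right

/-- `Π' = -i (A Π j + Π j V)` for the initial potential. -/
theorem hasEntryDeriv_PiMat (ha : a ≠ 0) (hAQ : A * Q = Q * A)
    (hQ : Q ^ 2 = (A - (c : ℂ) • 1) ^ 2 - ((‖a‖ : ℂ) ^ 2) • 1) (x : ℝ) :
    HasEntryDeriv (PiMat a c A Q f1 f2)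
      (-I • (A * PiMat a c A Q f1 f2 x * jMat p +
        PiMat a c A Q f1 f2 x * (jMat p * potMat (initialPot p a c x)))) x := by
  set b := (starRingEnd ℂ) a with hb
  have hb0 : b ≠ 0 := (map_ne_zero _).2 ha
  have hnorm : ((‖a‖ : ℂ) ^ 2) = a * b := by rw [hb, mul_conj, normSq_eq_norm_sq]; push_cast; rfl
  have hexp : ∀ t : ℝ, -((I * t) • Q) = (-I * t) • Q := fun t => by rw [neg_mul, neg_smul]
  set E := NormedSpace.exp ((I * x) • Q) with hE
  set E' := NormedSpace.exp ((-I * x) • Q) with hE'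
  set e := cexp (I * c * x) with he
  have hee : cexp (-I * c * x) * e = 1 := by
    rw [he, ← Complex.exp_add]; simp
  set e' := cexp (-I * c * x) with he'
  have hd := hasDerivAt_cexp_mul_ofReal (I * c) x
  have hd' := hasDerivAt_cexp_mul_ofReal (-I * c) x
  rw [← he] at hd
  rw [← he'] at hd'
  have hX : ∀ f g : Matrix (Fin n) (Fin p) ℂ,
      HasEntryDeriv (fun t : ℝ => NormedSpace.exp ((I * t) • Q) * f +
        NormedSpace.exp ((-I * t) • Q) * g) (I • (Q * (E * f)) - I • (Q * (E' * g))) x := by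
    intro f g
    refine (((hasEntryDeriv_exp_smul I Q x).mul_const f).add
      ((hasEntryDeriv_exp_smul (-I) Q x).mul_const g)).congr_deriv ?_
    simp only [Matrix.smul_mul, Matrix.neg_mul, Matrix.mul_assoc, neg_smul, sub_eq_add_neg, ← hE,
      ← hE']
  have hL1 := HasEntryDeriv.smul hd' (hX f1 f2)
  have hL2 := HasEntryDeriv.smul hd (hX (f3 a c A Q f1) (f4 a c A Q f2))
  have hEA : ∀ f : Matrix (Fin n) (Fin p) ℂ, E * (A * f) = A * (E * f) := fun f => by
    rw [← Matrix.mul_assoc, ← commute_exp_smul hAQ, Matrix.mul_assoc]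
  have hEA' : ∀ f : Matrix (Fin n) (Fin p) ℂ, E' * (A * f) = A * (E' * f) := fun f => by
    rw [← Matrix.mul_assoc, ← commute_exp_smul hAQ, Matrix.mul_assoc]
  have hEQ : ∀ f : Matrix (Fin n) (Fin p) ℂ, E * (Q * f) = Q * (E * f) := fun f => by
    rw [← Matrix.mul_assoc, ← commute_exp_smul rfl, Matrix.mul_assoc]
  have hEQ' : ∀ f : Matrix (Fin n) (Fin p) ℂ, E' * (Q * f) = Q * (E' * f) := fun f => by
    rw [← Matrix.mul_assoc, ← commute_exp_smul rfl, Matrix.mul_assoc]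
  have hQQ : ∀ f : Matrix (Fin n) (Fin p) ℂ,
      Q * (Q * f) = A * (A * f) - (2 * c : ℂ) • (A * f) + ((c : ℂ) ^ 2 - a * b) • f := fun f => by
    rw [← Matrix.mul_assoc, ← pow_two, hQ, hnorm, pow_two]
    simp only [Matrix.sub_mul, Matrix.mul_sub, Matrix.smul_mul, Matrix.mul_smul, Matrix.one_mul,
      Matrix.mul_one, Matrix.mul_assoc]
    module
  have hAQ' : ∀ f : Matrix (Fin n) (Fin p) ℂ, Q * (A * f) = A * (Q * f) := fun f => by
    rw [← Matrix.mul_assoc, ← hAQ, Matrix.mul_assoc]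
  have hfun : PiMat a c A Q f1 f2 = fun t : ℝ => fromCols
      (cexp (-I * c * t) • (NormedSpace.exp ((I * t) • Q) * f1 +
        NormedSpace.exp ((-I * t) • Q) * f2))
      (cexp (I * c * t) • (NormedSpace.exp ((I * t) • Q) * f3 a c A Q f1 +
        NormedSpace.exp ((-I * t) • Q) * f4 a c A Q f2)) := by
    funext t
    simp only [PiMat, Lam1, Lam2, hexp, neg_mul]
  have hF := hL1.fromCols hL2
  rw [← hfun, ← he, ← he', ← hE, ← hE'] at hF
  refine hF.congr_deriv ?_
  have hpot : potMat (initialPot p a c x) =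
      fromBlocks 0 ((a * e ^ 2) • 1) ((b * e' ^ 2) • 1) 0 := by
    have h1 : cexp (2 * I * c * x) = e ^ 2 := by
      rw [he, ← Complex.exp_nat_mul]; congr 1; push_cast; ring
    have h2 : (starRingEnd ℂ) (cexp (2 * I * c * x)) = e' ^ 2 := by
      rw [he', ← Complex.exp_nat_mul, ← exp_conj]; congr 1
      simp only [map_mul, conj_I, conj_ofReal, map_ofNat]; push_cast; ring
    simp only [potMat, initialPot, conjTranspose_smul, conjTranspose_one, star_def, map_mul, h2]
    rw [h1]
  have hPi : PiMat a c A Q f1 f2 x = fromCols (e' • (E * f1 + E' * f2))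
      (e • (E * f3 a c A Q f1 + E' * f4 a c A Q f2)) := by
    simp only [PiMat, Lam1, Lam2, hexp, hE, hE', he, he', neg_mul]
  rw [hPi, hpot]
  simp only [jMat, fromBlocks_multiply, mul_fromCols, fromCols_mul_fromBlocks, Matrix.mul_one,
    Matrix.mul_zero, Matrix.zero_mul, Matrix.one_mul, add_zero, zero_add, Matrix.mul_neg,
    Matrix.neg_mul]
  have hadd : ∀ M N M' N' : Matrix (Fin n) (Fin p) ℂ,
      -I • (fromCols M N + fromCols M' N') = fromCols (-I • (M + M')) (-I • (N + N')) := by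
    intro M N M' N'
    ext i (j | j) <;> rfl
  rw [hadd]
  simp only [f3, f4, Matrix.mul_add, Matrix.mul_sub, Matrix.add_mul, Matrix.sub_mul,
    Matrix.smul_mul, Matrix.mul_smul, Matrix.mul_neg, Matrix.mul_one, Matrix.one_mul,
    hEA, hEA', hEQ, hEQ', hQQ, hAQ', ← hb]
  have he0 : e ≠ 0 := fun h => by simp [h] at hee
  have he1 : e' = e⁻¹ := eq_inv_of_mul_eq_one_left hee
  rw [he1]
  congr 1
  -- The first column is what dictates f₃ and f₄.
  · match_scalars <;> field_simp <;> ring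
  -- The second column needs (Q + A - c)(Q - A + c) = -|a|², supplied by `hQQ` and commutation.
  · match_scalars <;> field_simp <;> ring

theorem hasEntryDeriv_SMat {S0 : Matrix (Fin n) (Fin n) ℂ}
    (hP : Continuous (PiMat a c A Q f1 f2)) (x : ℝ) :
    HasEntryDeriv (SMat a c A Q f1 f2 S0)
      (PiMat a c A Q f1 f2 x * (PiMat a c A Q f1 f2 x)ᴴ) x := by
  intro k l
  have hc : Continuous fun r => (PiMat a c A Q f1 f2 r * (PiMat a c A Q f1 f2 r)ᴴ) k l :=
    (hP.matrix_mul hP.matrix_conjTranspose).matrix_elem k l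
  exact (hc.integral_hasStrictDerivAt 0 x).hasDerivAt.const_add (S0 k l)

/-- The decaying solution `e^{iζx} [a e^{icx}; h e^{-icx}]` of the initial system. -/
noncomputable def decayingSolution (p : ℕ) (a h ζ : ℂ) (c : ℝ) (x : ℝ) :
    Matrix (Fin p ⊕ Fin p) (Fin p) ℂ :=
  fromRows ((a * cexp (I * (ζ + c) * x)) • 1) ((h * cexp (I * (ζ - c) * x)) • 1)

theorem hasEntryDeriv_decayingSolution {z ζ h : ℂ} (hζ : ζ ^ 2 = (z - c) ^ 2 - (‖a‖ : ℂ) ^ 2)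
    (hh : h = ζ - z + c) (x : ℝ) :
    HasEntryDeriv (decayingSolution p a h ζ c)
      (diracCoeff z (initialPot p a c x) * decayingSolution p a h ζ c x) x := by
  have hnorm : ((‖a‖ : ℂ) ^ 2) = a * (starRingEnd ℂ) a := by
    rw [mul_conj, normSq_eq_norm_sq]; push_cast; rfl
  rw [hnorm] at hζ
  have h1 : HasEntryDeriv (fun t : ℝ => (a * cexp (I * (ζ + c) * t)) •
      (1 : Matrix (Fin p) (Fin p) ℂ)) ((a * (I * (ζ + c) * cexp (I * (ζ + c) * x))) • 1) x :=
    (HasEntryDeriv.smul ((hasDerivAt_cexp_mul_ofReal (I * (ζ + c)) x).const_mul a)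
      (hasEntryDeriv_const 1)).congr_deriv (by simp)
  have h2 : HasEntryDeriv (fun t : ℝ => (h * cexp (I * (ζ - c) * t)) •
      (1 : Matrix (Fin p) (Fin p) ℂ)) ((h * (I * (ζ - c) * cexp (I * (ζ - c) * x))) • 1) x :=
    (HasEntryDeriv.smul ((hasDerivAt_cexp_mul_ofReal (I * (ζ - c)) x).const_mul h)
      (hasEntryDeriv_const 1)).congr_deriv (by simp)
  refine (h1.fromRows h2).congr_deriv ?_
  simp only [diracCoeff, jMat, potMat, initialPot, decayingSolution, fromBlocks_multiply,
    fromBlocks_smul, fromBlocks_add, fromBlocks_mul_fromRows, Matrix.one_mul, Matrix.mul_zero,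
    Matrix.zero_mul, add_zero, zero_add, smul_zero, conjTranspose_smul,
    conjTranspose_one, Matrix.smul_mul, Matrix.neg_mul, smul_neg, star_def, map_mul, smul_smul]
  have e1 : cexp (2 * I * c * x) * cexp (I * (ζ - c) * x) = cexp (I * (ζ + c) * x) := by
    rw [← Complex.exp_add]; congr 1; ring
  have e2 : (starRingEnd ℂ) (cexp (2 * I * c * x)) * cexp (I * (ζ + c) * x) =
      cexp (I * (ζ - c) * x) := by
    rw [← exp_conj, ← Complex.exp_add]; congr 1
    simp only [map_mul, conj_I, conj_ofReal, map_ofNat]; ring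
  congr 1
  · match_scalars
    rw [hh]
    linear_combination (-I * a * (ζ - z + c)) * e1
  · match_scalars
    rw [hh]
    linear_combination (I * a * (starRingEnd ℂ) a) * e2 + I * cexp (I * (ζ - c) * x) * hζ

/-- Multiply (z - c)h + |a|² = -ζh by the conjugate of h and take imaginary parts: Im z (|a|² +
|h|²) = Im ζ (|a|² - |h|²). -/
theorem normSq_h_lt {z ζ h : ℂ} (hz : 0 < z.im) (hζ : ζ ^ 2 = (z - c) ^ 2 - (‖a‖ : ℂ) ^ 2)
    (hζ' : 0 < ζ.im) (hh : h = ζ - z + c) (ha : a ≠ 0) : normSq h < normSq a := by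
  have hnorm : ((‖a‖ : ℂ) ^ 2) = (normSq a : ℂ) := by rw [normSq_eq_norm_sq]; push_cast; rfl
  have key : (ζ - (z - c)) * normSq a + (z - c) * normSq h + normSq a * (starRingEnd ℂ) h
      = h * normSq a - ζ * normSq h + normSq a * 0 := by
    have e2 : (z - c) * h + normSq a = -ζ * h := by
      rw [hh]; rw [hnorm] at hζ; linear_combination hζ
    have e3 : (normSq h : ℂ) = h * (starRingEnd ℂ) h := (mul_conj h).symm
    rw [e3, hh] at *
    linear_combination (starRingEnd ℂ) (ζ - z + c) * e2
  have h2 := congrArg Complex.im key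
  have h3 : h.im = ζ.im - z.im := by rw [hh]; simp
  simp at h2
  have hpos : 0 < normSq a := normSq_pos.2 ha
  have hpos' : 0 ≤ normSq h := normSq_nonneg h
  rw [h3] at h2
  by_contra! hcon
  nlinarith [mul_pos hz hpos, mul_nonneg hz.le hpos', mul_nonneg hζ'.le (sub_nonneg.2 hcon)]

theorem sub_h_ne_zero {h : ℂ} (hlt : normSq h < normSq a) : a - h ≠ 0 := fun h0 => by
  rw [sub_eq_zero.1 h0] at hlt
  exact lt_irrefl _ hlt

/-- As c is real, both exponentials have modulus e^{-x Im ζ}, so the sign is that of |a|² - |h|². -/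
theorem energy_decayingSolution_nonneg {q : Type*} [Fintype q] {h ζ : ℂ}
    (hlt : normSq h < normSq a) (U : Matrix (Fin p) q ℂ) (x : ℝ) :
    0 ≤ energy (decayingSolution p a h ζ c x * U) := by
  rw [energy_eq_sum]
  refine Finset.sum_nonneg fun l _ => ?_
  rw [← Finset.sum_sub_distrib]
  refine Finset.sum_nonneg fun k _ => ?_
  have e1 : ‖cexp (I * (ζ + c) * x)‖ = ‖cexp (I * (ζ - c) * x)‖ := by
    simp [Complex.norm_exp]
  simp only [normSq_eq_norm_sq] at hlt
  simp only [decayingSolution, fromRows_mul, fromRows_apply_inl, fromRows_apply_inr,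
    Matrix.smul_mul, Matrix.one_mul, Matrix.smul_apply, smul_eq_mul, norm_mul, mul_pow, e1]
  rw [← sub_mul, ← sub_mul]
  have := sub_nonneg.2 hlt.le
  positivity

end Initial

/-! ### Invertibility of `𝒜^× - z` -/

section Realisation

variable {n p : ℕ} {q : Type*}

theorem energy_fromRows [Fintype q] (u w : Matrix (Fin p) q ℂ) :
    energy (fromRows u w) = mass u - mass w := by
  simp only [energy_eq_sum, mass_eq_sum, fromRows_apply_inl, fromRows_apply_inr,
    Finset.sum_sub_distrib]

theorem mass_smul [Fintype q] (b : ℂ) (u : Matrix (Fin p) q ℂ) :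
    mass (b • u) = normSq b * mass u := by
  simp only [mass_eq_sum, Matrix.smul_apply, smul_eq_mul, norm_mul, mul_pow, normSq_eq_norm_sq,
    Finset.mul_sum]

theorem darboux_fromCols (L1 L2 : Matrix (Fin n) (Fin p) ℂ) (S : Matrix (Fin n) (Fin n) ℂ)
    (u w : Matrix (Fin p) q ℂ) (X : Matrix (Fin n) q ℂ) :
    darboux (fromCols L1 L2) S (fromRows u w) X =
      fromRows (u - I • (L1ᴴ * (S⁻¹ * X))) (w + I • (L2ᴴ * (S⁻¹ * X))) := by
  rw [darboux, conjTranspose_fromCols_eq_fromRows_conjTranspose, fromRows_mul, jMat,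
    fromBlocks_mul_fromRows]
  ext (i | i) j
  · simp
  · simp

theorem energy_darboux [Fintype q] {A S : Matrix (Fin n) (Fin n) ℂ}
    {P : Matrix (Fin n) (Fin p ⊕ Fin p) ℂ} (hS : S.PosDef)
    (hid : A * S - S * Aᴴ = I • (P * jMat p * Pᴴ)) {z : ℂ} {y : Matrix (Fin p ⊕ Fin p) q ℂ}
    {X : Matrix (Fin n) q ℂ} (hX : A * X = z • X + P * y) :
    energy (darboux P S y X) = energy y + 2 * z.im * (trace (Xᴴ * (S⁻¹ * X))).re := by
  rw [energy, darboux_form hS hid hX, trace_add, trace_smul, add_re, energy]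
  simp

theorem trace_quadratic_nonneg [Fintype q] {S : Matrix (Fin n) (Fin n) ℂ} (hS : S.PosDef)
    (X : Matrix (Fin n) q ℂ) : 0 ≤ (trace (Xᴴ * (S⁻¹ * X))).re := by
  rw [← Matrix.mul_assoc]
  exact (Complex.nonneg_iff.1 (hS.inv.posSemidef.conjTranspose_mul_mul_same X).trace_nonneg).1

variable {a h z : ℂ} {A S : Matrix (Fin n) (Fin n) ℂ} {L1 L2 : Matrix (Fin n) (Fin p) ℂ}

/-- A kernel vector g, with u = 𝒞₁g, satisfies Ag = zg + Π[au; hu], so the Darboux energy formula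
applies. The choice of 𝒞₁ makes the two blocks of the transformed vector equal, so its energy is 0.
But that energy is (|a|² - |h|²)‖u‖² + 2 Im z g^*S⁻¹g, which is positive unless g = 0. -/
theorem isUnit_calAx_sub (hz : 0 < z.im) (hlt : normSq h < normSq a) (hS : S.PosDef)
    (hid : A * S - S * Aᴴ = I • (fromCols L1 L2 * jMat p * (fromCols L1 L2)ᴴ)) :
    IsUnit (calAx a h A L1 L2 S - z • 1) := by
  rw [← Matrix.mulVec_injective_iff_isUnit]
  refine (injective_iff_map_eq_zero (Matrix.mulVecLin _)).2 fun g hg => ?_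
  set X := replicateCol Unit g with hX
  have hg' : (calAx a h A L1 L2 S - z • 1) * X = 0 := by
    rw [hX, ← replicateCol_mulVec]
    exact (congrArg (replicateCol Unit) hg).trans (by ext; rfl)
  set u := calC1 a h L1 L2 S * X with hu
  have hAX : A * X = z • X + fromCols L1 L2 * fromRows (a • u) (h • u) := by
    rw [fromCols_mul_fromRows]
    rw [calAx, Matrix.sub_mul, Matrix.sub_mul, Matrix.mul_assoc, ← hu, calB, Matrix.add_mul,
      Matrix.smul_mul, Matrix.smul_mul, Matrix.smul_mul, Matrix.one_mul, sub_eq_zero,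
      sub_eq_iff_eq_add] at hg'
    rw [hg', Matrix.mul_smul, Matrix.mul_smul]
  have hu' : (a - h) • u = I • (L1ᴴ * (S⁻¹ * X)) + I • (L2ᴴ * (S⁻¹ * X)) := by
    rw [hu, calC1, Matrix.smul_mul, smul_smul, mul_left_comm, mul_inv_cancel₀ (sub_h_ne_zero hlt),
      mul_one, Matrix.mul_assoc, Matrix.add_mul, smul_add]
  have h1 := energy_darboux hS hid hAX
  rw [darboux_fromCols, energy_fromRows, energy_fromRows, mass_smul, mass_smul] at h1
  have h2 : a • u - I • (L1ᴴ * (S⁻¹ * X)) = h • u + I • (L2ᴴ * (S⁻¹ * X)) := by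
    rw [sub_smul] at hu'
    rw [sub_eq_iff_eq_add, add_assoc, add_comm (I • (L2ᴴ * (S⁻¹ * X))), ← hu']
    abel
  rw [h2, sub_self] at h1
  by_contra hg0
  have h3 : 0 < (trace (Xᴴ * (S⁻¹ * X))).re := by
    have := (Complex.pos_iff.1 (hS.inv.dotProduct_mulVec_pos hg0)).1
    have e : trace (Xᴴ * (S⁻¹ * X)) = star g ⬝ᵥ (S⁻¹ *ᵥ g) := by
      simp [trace, hX, mul_apply, dotProduct, mulVec]
    rwa [e]
  have h4 : 0 ≤ (normSq a - normSq h) * mass u :=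
    mul_nonneg (sub_nonneg.2 hlt.le) (mass_nonneg u)
  have h5 : 0 < 2 * z.im * (trace (Xᴴ * (S⁻¹ * X))).re := by positivity
  linarith

/-! ### The Weyl solution -/

theorem Theta_conjTranspose (p : ℕ) :
    (Theta p)ᴴ = ((Real.sqrt 2 : ℝ) : ℂ)⁻¹ • fromBlocks 1 1 (-1) 1 := by
  simp [Theta, conjTranspose_smul, fromBlocks_conjTranspose]

theorem sqrt_two_mul_self : ((Real.sqrt 2 : ℝ) : ℂ) * ((Real.sqrt 2 : ℝ) : ℂ) = 2 := by
  rw [← ofReal_mul, Real.mul_self_sqrt (by norm_num)]; norm_num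

theorem sqrt_two_ne_zero : ((Real.sqrt 2 : ℝ) : ℂ) ≠ 0 := fun h => by
  have := sqrt_two_mul_self
  simp [h] at this

/-- The initial data `Θ^* [I; -i φ]`. -/
noncomputable def weylData (φ : Matrix (Fin p) (Fin p) ℂ) : Matrix (Fin p ⊕ Fin p) (Fin p) ℂ :=
  (Theta p)ᴴ * fromRows (1 : Matrix (Fin p) (Fin p) ℂ) (-(I • φ))

/-- The initial value of the Weyl solution: with `G = (𝒜^× - z)⁻¹ ℬ` and `U = I + 𝒞₁ G`, the
transformed solution starts at a multiple of `Θ^* [I; -i φ]`. -/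
theorem darboux_initial_value (hah : a - h ≠ 0) (hu : IsUnit (calAx a h A L1 L2 S - z • 1)) :
    ∃ (G : Matrix (Fin n) (Fin p) ℂ) (U : Matrix (Fin p) (Fin p) ℂ),
      A * G = z • G + fromCols L1 L2 * fromRows (a • U) (h • U) ∧
      weylData (realisation a h z A L1 L2 S) =
        (((Real.sqrt 2 : ℝ) : ℂ) / (a - h)) •
          darboux (fromCols L1 L2) S (fromRows (a • U) (h • U)) G := by
  set G := (calAx a h A L1 L2 S - z • 1)⁻¹ * calB a h L1 L2 with hG
  refine ⟨G, 1 + calC1 a h L1 L2 S * G, ?_, ?_⟩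
  · have h1 : (calAx a h A L1 L2 S - z • 1) * G = calB a h L1 L2 := by
      rw [hG, mul_nonsing_inv_cancel_left _ _ ((Matrix.isUnit_iff_isUnit_det _).1 hu)]
    rw [calAx, Matrix.sub_mul, Matrix.sub_mul, Matrix.smul_mul, Matrix.one_mul,
      sub_eq_iff_eq_add, sub_eq_iff_eq_add] at h1
    rw [fromCols_mul_fromRows, h1]
    simp only [calB, Matrix.add_mul, Matrix.mul_add, Matrix.smul_mul, Matrix.mul_smul,
      Matrix.mul_one, Matrix.mul_assoc]
    module
  -- The blocks of Θ^*[I; -iφ] differ by √2 I, and those of the Darboux vector by (a - h)U - i(Λ₁^*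
  -- + Λ₂^*)S⁻¹G = (a - h)I; hence the factor √2/(a - h). The sum of the blocks then determines φ.
  · have h2 := sqrt_two_mul_self
    have h3 := sqrt_two_ne_zero
    set s := ((Real.sqrt 2 : ℝ) : ℂ) with hs
    rw [darboux_fromCols, weylData, realisation, Matrix.mul_assoc _ _ (calB a h L1 L2), ← hG,
      Theta_conjTranspose, ← hs, Matrix.smul_mul, fromBlocks_mul_fromRows]
    simp only [calC1, calC2, calD, ← hs, Matrix.sub_mul, Matrix.smul_mul, Matrix.one_mul,
      Matrix.mul_assoc, Matrix.add_mul, Matrix.mul_neg, Matrix.mul_one]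
    set P1 := L1ᴴ * (S⁻¹ * G)
    set P2 := L2ᴴ * (S⁻¹ * G)
    have hr : ∀ (b : ℂ) (M N : Matrix (Fin p) (Fin p) ℂ),
        b • fromRows M N = fromRows (b • M) (b • N) := fun b M N => by
      ext (i | i) j <;> rfl
    rw [hr, hr]
    have h4 : s ^ 2 = 2 := by rw [pow_two, h2]
    congr 1
    · match_scalars <;> field_simp <;> simp only [h4, I_sq] <;> ring_nf
    · match_scalars <;> field_simp <;> simp only [h4, I_sq] <;> ring_nf

/-- The auxiliary function `X` with `X' = -i Π j y` keeps the relation `(A - z) X = Π y`. -/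
theorem exists_auxiliary {v : ℝ → Matrix (Fin p) (Fin p) ℂ} [Fintype q]
    {P : ℝ → Matrix (Fin n) (Fin p ⊕ Fin p) ℂ} {y : ℝ → Matrix (Fin p ⊕ Fin p) q ℂ}
    (hP : ∀ x, HasEntryDeriv P (-I • (A * P x * jMat p + P x * (jMat p * potMat (v x)))) x)
    (hy : ∀ x, HasEntryDeriv y (diracCoeff z (v x) * y x) x) {G : Matrix (Fin n) q ℂ}
    (hG : A * G = z • G + P 0 * y 0) :
    ∃ X : ℝ → Matrix (Fin n) q ℂ, X 0 = G ∧
      (∀ x, HasEntryDeriv X (-I • (P x * (jMat p * y x))) x) ∧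
      ∀ x, A * X x = z • X x + P x * y x := by
  have hPc : Continuous P := continuous_iff_continuousAt.2 fun x => (hP x).continuousAt
  have hyc : Continuous y := continuous_iff_continuousAt.2 fun x => (hy x).continuousAt
  -- X is obtained by integration instead of as (A - z)⁻¹Πy, since z may be an eigenvalue of A.
  set X : ℝ → Matrix (Fin n) q ℂ := fun x =>
    G + Matrix.of fun k l => ∫ r in (0 : ℝ)..x, (-I • (P r * (jMat p * y r))) k l with hX
  have hX0 : X 0 = G := by
    ext k l
    simp [hX]
  have hXd : ∀ x, HasEntryDeriv X (-I • (P x * (jMat p * y x))) x := fun x k l => by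
    have hc : Continuous fun r => (-I • (P r * (jMat p * y r))) k l :=
      ((hPc.matrix_mul (continuous_const.matrix_mul hyc)).const_smul (-I)).matrix_elem k l
    exact (hc.integral_hasStrictDerivAt 0 x).hasDerivAt.const_add (G k l)
  refine ⟨X, hX0, hXd, fun x => ?_⟩
  have hd : ∀ x, HasEntryDeriv (fun t => A * X t - z • X t - P t * y t) 0 x := fun x => by
    refine ((((hXd x).const_mul A).sub ((hXd x).const_smul z)).sub
      ((hP x).mul (hy x))).congr_deriv ?_
    simp only [diracCoeff, Matrix.add_mul, Matrix.mul_add, Matrix.smul_mul, Matrix.mul_smul,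
      Matrix.mul_assoc]
    module
  have h0 := eq_of_hasEntryDeriv_zero hd x 0
  rw [hX0, hG] at h0
  have h1 : A * X x - z • X x - P x * y x = 0 := h0.trans (by abel)
  rw [sub_sub, sub_eq_zero] at h1
  exact h1

end Realisation

/-! ### Weyl functions -/

section Weyl

variable {p : ℕ}

theorem weylIntegrand_eq (φ : Matrix (Fin p) (Fin p) ℂ)
    (W : Matrix (Fin p ⊕ Fin p) (Fin p ⊕ Fin p) ℂ) :
    weylIntegrand φ W = (W * weylData φ)ᴴ *
      (W * weylData φ) := by
  have h : (fromRows (1 : Matrix (Fin p) (Fin p) ℂ) (-(I • φ)))ᴴ = fromCols 1 (I • φᴴ) := by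
    rw [conjTranspose_fromRows_eq_fromCols_conjTranspose]
    simp
  simp only [weylIntegrand, weylData, conjTranspose_mul, conjTranspose_conjTranspose, h, Matrix.mul_assoc]

/-- The mass is the trace of the Gram matrix, and each entry is bounded by the number of rows times
the mass. Thus finiteness of the Weyl integral is square integrability of the solution. -/
theorem integrableOn_gram_iff {m q : Type*} [Fintype m] [Fintype q] {Y : ℝ → Matrix m q ℂ}
    (hY : ContinuousOn Y (Ioi 0)) :
    (∀ k l, IntegrableOn (fun x => ((Y x)ᴴ * Y x) k l) (Ioi 0)) ↔
      IntegrableOn (fun x => mass (Y x)) (Ioi 0) := by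
  constructor
  · intro h
    have h1 : IntegrableOn (fun x => ∑ l, ((Y x)ᴴ * Y x) l l) (Ioi 0) :=
      integrable_finsetSum _ fun l _ => h l l
    exact h1.re
  · intro h k l
    have hc : ContinuousOn (fun x => ((Y x)ᴴ * Y x) k l) (Ioi 0) := by
      have : Continuous fun M : Matrix m q ℂ => (Mᴴ * M) k l :=
        (continuous_id.matrix_conjTranspose.matrix_mul continuous_id).matrix_elem k l
      exact this.comp_continuousOn hY
    refine Integrable.mono' (h.const_mul (Fintype.card m : ℝ))
      (hc.aestronglyMeasurable measurableSet_Ioi) (.of_forall fun x => ?_)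
    rw [mul_apply]
    refine (norm_sum_le _ _).trans ((Finset.sum_le_card_nsmul _ _ (mass (Y x)) fun r _ => ?_).trans
      (by simp))
    have h1 := norm_sq_le_mass (Y x) r k
    have h2 := norm_sq_le_mass (Y x) r l
    rw [conjTranspose_apply, norm_mul, norm_star]
    nlinarith [sq_nonneg (‖Y x r k‖ - ‖Y x r l‖)]

theorem IsNormalisedFundamentalSolution.hasEntryDerivWithin
    {v : ℝ → Matrix (Fin p) (Fin p) ℂ} {z : ℂ}
    {W : ℝ → Matrix (Fin p ⊕ Fin p) (Fin p ⊕ Fin p) ℂ}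
    (hW : IsNormalisedFundamentalSolution v z W) {x : ℝ} (hx : 0 ≤ x) :
    HasEntryDerivWithin W (diracCoeff z (v x) * W x) (Ici 0) x := fun k l => by
  rw [diracCoeff, Matrix.smul_mul]
  exact hW.2 x hx k l

/-- A function whose values are the initial data of solutions with nonnegative energy is the only
Weyl function. -/
theorem isWeylFunction_iff {v : ℝ → Matrix (Fin p) (Fin p) ℂ} (hv : ContinuousOn v (Ici 0))
    {φ₀ : ℂ → Matrix (Fin p) (Fin p) ℂ}
    (h₀ : ∀ z : ℂ, 0 < z.im → ∃ Y : ℝ → Matrix (Fin p ⊕ Fin p) (Fin p) ℂ,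
      (∀ x, 0 ≤ x → HasEntryDeriv Y (diracCoeff z (v x) * Y x) x) ∧
      (∀ x, 0 ≤ x → 0 ≤ energy (Y x)) ∧ Y 0 = weylData (φ₀ z))
    (φ : ℂ → Matrix (Fin p) (Fin p) ℂ) :
    IsWeylFunction v φ ↔ ∀ z : ℂ, 0 < z.im → φ z = φ₀ z := by
  refine forall₂_congr fun z hz => ?_
  have hM : ContinuousOn (fun x => diracCoeff z (v x)) (Ici 0) := by
    have : Continuous fun w : Matrix (Fin p) (Fin p) ℂ => diracCoeff z w := by
      refine (continuous_const.add (continuous_const.matrix_mul ?_)).const_smul I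
      exact continuous_const.matrix_fromBlocks continuous_id
        continuous_id.matrix_conjTranspose continuous_const
    exact this.comp_continuousOn hv
  obtain ⟨W, hW0, hW⟩ := exists_matrix_fundamentalSolution hM
  obtain ⟨Y, hY, hYE, hY0⟩ := h₀ z hz
  have hsol : ∀ C : Matrix (Fin p ⊕ Fin p) (Fin p) ℂ, ∀ x, 0 ≤ x →
      HasEntryDeriv (fun t => W t * C) (diracCoeff z (v x) * (W x * C)) x := fun C x hx =>
    ((hW x hx).mul_const C).congr_deriv (Matrix.mul_assoc _ _ _)
  have hcont : ∀ C : Matrix (Fin p ⊕ Fin p) (Fin p) ℂ,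
      ContinuousOn (fun t => W t * C) (Ioi 0) := fun C x hx =>
    (hsol C x (le_of_lt hx)).continuousAt.continuousWithinAt
  have hunique : ∀ C : Matrix (Fin p ⊕ Fin p) (Fin p) ℂ, Y 0 = C → ∀ x, 0 ≤ x →
      Y x = W x * C := fun C hC x hx =>
    eqOn_of_linear_ode hM (fun t ht => (hY t ht).within) (fun t ht => (hsol C t ht).within)
      (by rw [hC, hW0, Matrix.one_mul]) hx
  have hmass₀ : IntegrableOn (fun x => mass (W x * weylData (φ₀ z)))
      (Ioi 0) :=
    (integrableOn_mass hz hY hYE).congr_fun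
      (fun x hx => by simp only [hunique _ hY0 x (le_of_lt hx)]) measurableSet_Ioi
  constructor
  · rintro ⟨W', hW', hint⟩
    have hWW : ∀ x, 0 ≤ x → W' x = W x := fun x hx =>
      eqOn_of_linear_ode hM (fun t ht => hW'.hasEntryDerivWithin ht)
        (fun t ht => (hW t ht).within) (hW'.1.trans hW0.symm) hx
    have hmass : IntegrableOn (fun x => mass (W x * weylData (φ z)))
        (Ioi 0) := by
      refine (integrableOn_gram_iff (hcont _)).1 fun k l => ?_
      refine (hint k l).congr_fun (fun x hx => ?_) measurableSet_Ioi
      simp only [weylIntegrand_eq, hWW x (le_of_lt hx)]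
    set D := φ z - φ₀ z with hD
    set C : Matrix (Fin p ⊕ Fin p) (Fin p) ℂ :=
      (Theta p)ᴴ * fromRows (0 : Matrix (Fin p) (Fin p) ℂ) (-(I • D)) with hC
    have hCsub : C = weylData (φ z) -
        weylData (φ₀ z) := by
      rw [hC, weylData, weylData, ← Matrix.mul_sub]
      congr 1
      ext (i | i) j
      · simp
      · simp [hD, mul_sub]
        ring
    have hmassC : IntegrableOn (fun x => mass (W x * C)) (Ioi 0) := by
      refine Integrable.mono' ((hmass.const_mul 2).add (hmass₀.const_mul 2))
        ((continuousOn_mass (hcont C)).aestronglyMeasurable measurableSet_Ioi)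
        (.of_forall fun x => ?_)
      rw [Real.norm_of_nonneg (mass_nonneg _), hCsub, Matrix.mul_sub]
      exact mass_sub_le _ _
    -- Equal blocks are neutral for j: the difference of the two solutions starts with zero energy.
    have hCrows : C = fromRows ((-(I * ((Real.sqrt 2 : ℝ) : ℂ)⁻¹)) • D)
        ((-(I * ((Real.sqrt 2 : ℝ) : ℂ)⁻¹)) • D) := by
      rw [hC, Theta_conjTranspose, Matrix.smul_mul, fromBlocks_mul_fromRows]
      ext (i | i) j <;> simp <;> ring
    have hzero := eq_zero_of_integrableOn_mass hz (Y := fun t => W t * C) (hsol C)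
      (by simp only [hW0, Matrix.one_mul]; rw [hCrows, energy_fromRows, sub_self]) hmassC
    simp only [hW0, Matrix.one_mul] at hzero
    have hD0 : D = 0 := by
      ext i j
      have := congrFun (congrFun (hCrows.symm.trans hzero) (.inl i)) j
      simpa [sqrt_two_ne_zero] using this
    exact sub_eq_zero.1 hD0
  · intro hφ
    refine ⟨W, ⟨hW0, fun x hx k l => ?_⟩, ?_⟩
    · rw [← Matrix.smul_mul]
      exact ((hW x hx) k l).hasDerivWithinAt
    · rw [hφ]
      simp only [weylIntegrand_eq]
      exact (integrableOn_gram_iff (hcont _)).2 hmass₀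

end Weyl

end DiracWeyl

/-! ### The Weyl function of the transformed system. -/

theorem mainTheorem2 {n p : ℕ} (hn : 0 < n) (hp : 0 < p)
    (a : ℂ) (ha : a ≠ 0) (c : ℝ)
    (A Q : Matrix (Fin n) (Fin n) ℂ)
    (hdet : ((A - (c : ℂ) • 1) ^ 2 - ((‖a‖ : ℂ) ^ 2) • 1).det ≠ 0)
    (hAQ : A * Q = Q * A)
    (hQ : Q ^ 2 = (A - (c : ℂ) • 1) ^ 2 - ((‖a‖ : ℂ) ^ 2) • 1)
    (f1 f2 : Matrix (Fin n) (Fin p) ℂ)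
    (S0 : Matrix (Fin n) (Fin n) ℂ)
    (hid : A * S0 - S0 * Aᴴ =
      Complex.I • (DiracWeyl.PiMat a c A Q f1 f2 0 * DiracWeyl.jMat p *
        (DiracWeyl.PiMat a c A Q f1 f2 0)ᴴ))
    (hS0 : S0.PosDef)
    (ζ : ℂ → ℂ)
    (hζ : ∀ z : ℂ, 0 < z.im → ζ z ^ 2 = (z - c) ^ 2 - (‖a‖ : ℂ) ^ 2 ∧ 0 < (ζ z).im) :
    (∀ x : ℝ, 0 ≤ x → IsUnit (DiracWeyl.SMat a c A Q f1 f2 S0 x)) ∧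
    (∀ z : ℂ, 0 < z.im → a - DiracWeyl.hFun c ζ z ≠ 0 ∧
      IsUnit (DiracWeyl.calAx a (DiracWeyl.hFun c ζ z) A
        (DiracWeyl.Lam1 c Q f1 f2 0) (DiracWeyl.Lam2 a c A Q f1 f2 0) S0 - z • 1)) ∧
    (∀ φ : ℂ → Matrix (Fin p) (Fin p) ℂ,
      DiracWeyl.IsWeylFunction (DiracWeyl.transformedPot a c A Q f1 f2 S0) φ ↔
        ∀ z : ℂ, 0 < z.im →
          φ z = DiracWeyl.realisation a (DiracWeyl.hFun c ζ z) z A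
            (DiracWeyl.Lam1 c Q f1 f2 0) (DiracWeyl.Lam2 a c A Q f1 f2 0) S0) := by
  open DiracWeyl in
  have hP := fun x => hasEntryDeriv_PiMat (f1 := f1) (f2 := f2) ha hAQ hQ x
  have hPc : Continuous (PiMat a c A Q f1 f2) :=
    continuous_iff_continuousAt.2 fun x => (hP x).continuousAt
  have hS := fun x => hasEntryDeriv_SMat (S0 := S0) hPc x
  have hS00 : SMat a c A Q f1 f2 S0 0 = S0 := by
    ext k l
    simp [SMat]
  have hpos : ∀ x, 0 ≤ x → (SMat a c A Q f1 f2 S0 x).PosDef := fun x hx =>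
    posDef_of_hasEntryDeriv hS (by rw [hS00]; exact hS0) hx
  have hidx := commutator_identity hP hS (by rw [hS00]; exact hid)
  have hlt : ∀ z : ℂ, 0 < z.im → normSq (hFun c ζ z) < normSq a := fun z hz =>
    normSq_h_lt hz (hζ z hz).1 (hζ z hz).2 rfl ha
  have hunit := fun z hz => isUnit_calAx_sub hz (hlt z hz) hS0 hid
  refine ⟨fun x hx => (hpos x hx).isUnit, fun z hz => ⟨sub_h_ne_zero (hlt z hz), hunit z hz⟩, ?_⟩
  refine isWeylFunction_iff ?_ fun z hz => ?_
  · have hL1 : Continuous (Lam1 c Q f1 f2) := by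
      refine continuous_pi fun k => continuous_pi fun l => ?_
      exact hPc.matrix_elem k (.inl l)
    have hL2 : Continuous (Lam2 a c A Q f1 f2) := by
      refine continuous_pi fun k => continuous_pi fun l => ?_
      exact hPc.matrix_elem k (.inr l)
    have hSi : ContinuousOn (fun x => (SMat a c A Q f1 f2 S0 x)⁻¹) (Ici 0) := fun x hx =>
      ((hS x).inv (hpos x hx).isUnit).continuousAt.continuousWithinAt
    have hv : Continuous (initialPot p a c) := by
      unfold initialPot
      fun_prop
    refine hv.continuousOn.sub (ContinuousOn.const_smul ?_ (2 * I))
    rw [continuousOn_iff_continuous_domRestrict] at hSi ⊢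
    exact ((hL1.comp continuous_subtype_val).matrix_conjTranspose.matrix_mul hSi).matrix_mul
      (hL2.comp continuous_subtype_val)
  · have hah := sub_h_ne_zero (hlt z hz)
    obtain ⟨G, U, hG, hGU⟩ := darboux_initial_value hah (hunit z hz)
    set k : ℂ := ((Real.sqrt 2 : ℝ) : ℂ) / (a - hFun c ζ z) with hk
    have hy : ∀ x, HasEntryDeriv
        (fun t => decayingSolution p a (hFun c ζ z) (ζ z) c t * U)
        (diracCoeff z (initialPot p a c x) *
          (decayingSolution p a (hFun c ζ z) (ζ z) c x * U)) x := fun x =>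
      ((hasEntryDeriv_decayingSolution (hζ z hz).1 rfl x).mul_const U).congr_deriv
        (Matrix.mul_assoc _ _ _)
    have hy0 : decayingSolution p a (hFun c ζ z) (ζ z) c 0 * U =
        fromRows (a • U) (hFun c ζ z • U) := by
      simp [decayingSolution, fromRows_mul]
    obtain ⟨X, hX0, hXd, hAX⟩ := exists_auxiliary hP hy (G := G) (by rw [hy0]; exact hG)
    have hYd : ∀ x, 0 ≤ x → HasEntryDeriv
        (fun t => darboux (PiMat a c A Q f1 f2 t) (SMat a c A Q f1 f2 S0 t)
          (decayingSolution p a (hFun c ζ z) (ζ z) c t * U) (X t)) _ x := fun x hx =>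
      hasEntryDeriv_darboux (hP x) (hS x) (hpos x hx) (hidx x) (hy x) (hXd x) (hAX x)
    have hYE : ∀ x, 0 ≤ x → 0 ≤ energy (darboux (PiMat a c A Q f1 f2 x)
        (SMat a c A Q f1 f2 S0 x) (decayingSolution p a (hFun c ζ z) (ζ z) c x * U) (X x)) := by
      intro x hx
      rw [energy_darboux (hpos x hx) (hidx x) (hAX x)]
      have h1 := energy_decayingSolution_nonneg (c := c) (ζ := ζ z) (hlt z hz) U x
      have h2 := trace_quadratic_nonneg (hpos x hx) (X x)
      positivity
    -- The scalar `k` is the normalisation from `darboux_initial_value`; it multiplies the energy by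
    -- |k|² and so preserves its sign.
    refine ⟨fun t => k • darboux (PiMat a c A Q f1 f2 t) (SMat a c A Q f1 f2 S0 t)
      (decayingSolution p a (hFun c ζ z) (ζ z) c t * U) (X t), fun x hx => ?_, fun x hx => ?_, ?_⟩
    · refine ((hYd x hx).const_smul k).congr_deriv ?_
      rw [Matrix.mul_smul, transformedPot, diracCoeff_transform z _ (hpos x hx)]
      rfl
    · have h1 : ∀ Y : Matrix (Fin p ⊕ Fin p) (Fin p) ℂ,
          energy (k • Y) = normSq k * energy Y := fun Y => by
        simp only [energy_eq_sum, Matrix.smul_apply, smul_eq_mul, norm_mul, mul_pow,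
          normSq_eq_norm_sq, Finset.mul_sum, mul_sub]
      rw [h1]
      exact mul_nonneg (normSq_nonneg _) (hYE x hx)
    · simp only [hX0, hy0, hS00]
      exact hGU.symm
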